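/- **Theorem (optimal convergence of Lie group Galerkin variational integrators).** *Setting.* Let $G$ be a finite-dimensional real Lie group with Lie algebra $\mathfrak g$, let $\langle\cdot,\cdot\rangle$ be an inner product on $\mathfrak g$ and $|\xi|=\langle\xi,\xi\rangle^{1/2}$, and let $L:TG\to\mathbb R$ be a $C^2$ Lagrangian. Let $\Phi:\mathfrak g\to G$ be a smooth local diffeomorphism on an open set $U\subseteq\mathfrak g$, let $b\in G$ be a base point and $\chi(x)=b\,\Phi(x)$, so that $\chi^{-1}$ is (locally) the natural chart at $b$. Let $W\subseteq U\times\mathfrak g$ be the region of positions and velocities in which the assumptions below are made ($W=\mathfrak g\times\mathfrak g$ if they hold globally). A curve $\xi$ on $[0,h]$ is *admissible* if it is $C^2$ and $(\xi(t),\dot\xi(t))\in W$ for all $t$; it *joins* $g_0$ to $g_1$ if $\chi(\xi(0))=g_0$ and $\chi(\xi(h))=g_1$. Let $\mathfrak S_h(g)=\int_0^hL(g,\dot g)\,dt$. Fix weights $w_j\in\mathbb R$ and nodes $c_j\in[0,1]$, $1\le j\le m$, and let $\mathfrak S_{d,h}(g)=h\sum_{j=1}^m w_jL(g(c_jh),\dot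 g(c_jh))$. Let $h_0>0$ and $n\in\mathbb N$, and for every $h\in(0,h_0]$ let $\mathcal A_h=\{\sum_i\xi^i\varphi_{h,i}:\xi^i\in\mathfrak g\}$ be the space of curves in $\mathfrak g$ spanned by finitely many given $C^2$ functions $\varphi_{h,i}:[0,h]\to\mathbb R$. For each $h\in(0,h_0]$ let $P_h\subseteq G\times G$ be a set of pairs of end points. For $(g_0,g_1)\in P_h$ let $\bar g=\chi(\bar\eta)$, with $\bar\eta$ admissible, be a solution on $[0,h]$ of the Euler–Lagrange equations of $L$ joining $g_0$ to $g_1$, and let $\tilde g_n=\chi(\tilde\eta)$, with $\tilde\eta\in\mathcal A_h$ admissible and joining $g_0$ to $g_1$, be stationary for $\mathfrak S_{d,h}$ with respect to variations of $\tilde\eta$ in $\mathcal A_h$ vanishing at $0$ and $h$. The exact and the Galerkin discrete Lagrangian are $$L_d^E(g_0,g_1,h)=\mathfrak S_h(\bar g),\qquad L_d(g_0,g_1,h)=\mathfrak S_{d,h}(\tilde g_n).$$ *Assumptions*, with nonnegative constants independent of $h\in(0,h_0]$ and of $(g_0,g_1)\in P_h$, and with error functions $e_G:G\times G\to\mathbb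 R$ and $e_T:TG\times TG\to\mathbb R$: 1. there is an admissible $\hat\eta\in\mathcal A_h$ joining $g_0$ to $g_1$ with $|\bar\eta(t)-\hat\eta(t)|\le C_A h^n$ and $|\dot{\bar\eta}(t)-\dot{\hat\eta}(t)|\le C_A' h^n$ on $[0,h]$; 2. $|L(g_1,\dot g_1)-L(g_2,\dot g_2)|\le C_L\big(e_G(g_1,g_2)+e_T(\dot g_1,\dot g_2)\big)$ for $(g_i,\dot g_i)=(\chi(x_i),d\chi_{x_i}v_i)$ with $(x_i,v_i)\in W$; 3. $e_G(\chi(x),\chi(x'))\le C_G|x-x'|$ and $e_T(d\chi_xv,d\chi_{x'}v')\le C_T|v-v'|+C_{GT}|x-x'|$ for $(x,v),(x',v')\in W$; 4. $|\mathfrak S_h(\chi(\xi))-\mathfrak S_{d,h}(\chi(\xi))|\le C_Q h^{n+1}$ for every admissible $\xi\in\mathcal A_h$; 5. for $(g_0,g_1)\in P_h$, every admissible stationary point of $\mathfrak S_{d,h}$ in $\mathcal A_h$ joining $g_0$ to $g_1$ minimizes $\mathfrak S_{d,h}$ among the admissible curves of $\mathcal A_h$ joining $g_0$ to $g_1$,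 and every admissible solution of the Euler–Lagrange equations joining $g_0$ to $g_1$ minimizes $\mathfrak S_h$ among all admissible curves joining $g_0$ to $g_1$. *Conclusion (discrete Lagrangian).* For all $h\in(0,h_0]$ and $(g_0,g_1)\in P_h$, $$|L_d^E(g_0,g_1,h)-L_d(g_0,g_1,h)|\le\big(C_Q+C_L((C_G+C_{GT})C_A+C_TC_A')\big)h^{n+1}.$$ *Conclusion (integrator).* Let $n\ge1$, let $W$ be open, let $Z\subseteq W$ be open with $(\chi(x),\chi(x+hv))\in P_h$ for $(x,v)\in Z$ and $h\in(0,h_0]$, let $L$ be smooth, with $\ell(x,v)=L(d\chi_xv)$ having nondegenerate second derivative in $v$ on $Z$, and let $L_d$ and $L_d^E$ be smooth up to $h=0$, that is, $(x,v,h)\mapsto L_d(\chi(x),\chi(x+hv),h)$, and likewise for $L_d^E$, is smooth on $Z\times[0,h_0)$. Then the variational integrator induced by $L_d$ has one-step error $O(h^{n+1})$. Precisely, write $\ell_d(x,y)=L_d(\chi(x),\chi(y),h)$. For every compact $K\subseteq Z$ there are $C$, $r>0$ and $h_1>0$ such that for all $h\in(0,h_1)$ and $(x_0,v_0)\in K$: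 * (phase space map) There is $y$ with $|y-x_0-hv_0|\le rh$ and $-D_1\ell_d(x_0,y)=\partial_v\ell(x_0,v_0)$. For every such $y$, and every admissible solution $\gamma$ of the Euler–Lagrange equations on $[0,h]$ with $\gamma(0)=x_0$, $\dot\gamma(0)=v_0$, one has $|y-\gamma(h)|\le Ch^{n+1}$, $e_G(\chi(y),\chi(\gamma(h)))\le Ch^{n+1}$ and $\|D_2\ell_d(x_0,y)-\partial_v\ell(\gamma(h),\dot\gamma(h))\|\le Ch^{n+1}$. * (update map) For every admissible solution $\gamma$ on $[0,2h]$ with $\gamma(0)=x_0$, $\dot\gamma(0)=v_0$, there is $y$ with $|y-\gamma(h)-hv_0|\le rh$ and $D_2\ell_d(\gamma(0),\gamma(h))+D_1\ell_d(\gamma(h),y)=0$, and every such $y$ satisfies $|y-\gamma(2h)|\le Ch^{n+1}$ and $e_G(\chi(y),\chi(\gamma(2h)))\le Ch^{n+1}$. -/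

import Mathlib

open Set
open scoped Manifold ContDiff

noncomputable section

namespace LieGalerkin

section Curves

variable {E : Type*} [NormedAddCommGroup E] [NormedSpace ℝ E]
  {V : Type*} [NormedAddCommGroup V] [InnerProductSpace ℝ V]
  {G : Type*} [TopologicalSpace G] [ChartedSpace E G]

/-- The parametrization `x ↦ L_b Φ(x)` of a neighbourhood in `G` whose inverse is the natural chart
with base point `b`.  The Lie algebra is identified by `e` with an inner product space `V`, so
that the norm of `V` is `⟨ξ, ξ⟩^{1/2}` for the chosen metric on the Lie algebra. -/
def natChart [Group G] (e : V ≃L[ℝ] GroupLieAlgebra 𝓘(ℝ, E) G)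
    (Φ : GroupLieAlgebra 𝓘(ℝ, E) G → G) (b : G) (x : V) : G :=
  b * Φ (e x)

/-- The tangent map of `χ : V → G`, as a map `V × V → TG`. -/
def tangentLift (χ : V → G) (z : V × V) : TangentBundle 𝓘(ℝ, E) G :=
  ⟨χ z.1, mfderiv 𝓘(ℝ, V) 𝓘(ℝ, E) χ z.1 z.2⟩

/-- The point `(g(t), ġ(t))` of `TG`, for a curve `g` on `[0,h]`. -/
def velocity (h : ℝ) (g : ℝ → G) (t : ℝ) : TangentBundle 𝓘(ℝ, E) G :=
  ⟨g t, mfderivWithin 𝓘(ℝ, ℝ) 𝓘(ℝ, E) g (Icc 0 h) t (1 : ℝ)⟩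

/-- The pair `(ξ(t), ξ̇(t))`, for a curve `ξ` on `[0,h]` in the Lie algebra. -/
def jet (h : ℝ) (ξ : ℝ → V) (t : ℝ) : V × V :=
  (ξ t, derivWithin ξ (Icc 0 h) t)

/-- Chain rule: the velocity of `χ ∘ ξ` is the tangent lift of `(ξ, ξ̇)`. -/
theorem velocity_comp (χ : V → G) {h : ℝ} (hh : 0 < h) (ξ : ℝ → V) {t : ℝ}
    (ht : t ∈ Icc 0 h) (hξ : DifferentiableWithinAt ℝ ξ (Icc 0 h) t)
    (hχ : MDifferentiableAt 𝓘(ℝ, V) 𝓘(ℝ, E) χ (ξ t)) :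
    (velocity h (fun s => χ (ξ s)) t : TangentBundle 𝓘(ℝ, E) G) =
      tangentLift χ (jet h ξ t) := by
  have hu : UniqueMDiffWithinAt 𝓘(ℝ, ℝ) (Icc 0 h) t :=
    uniqueMDiffWithinAt_iff_uniqueDiffWithinAt.2 (uniqueDiffOn_Icc hh t ht)
  have h1 : mfderivWithin 𝓘(ℝ, ℝ) 𝓘(ℝ, E) (χ ∘ ξ) (Icc 0 h) t =
      (mfderiv 𝓘(ℝ, V) 𝓘(ℝ, E) χ (ξ t)).comp
        (mfderivWithin 𝓘(ℝ, ℝ) 𝓘(ℝ, V) ξ (Icc 0 h) t) :=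
    mfderiv_comp_mfderivWithin t hχ hξ.mdifferentiableWithinAt hu
  have h2 : mfderivWithin 𝓘(ℝ, ℝ) 𝓘(ℝ, E) (fun s => χ (ξ s)) (Icc 0 h) t (1 : ℝ) =
      mfderiv 𝓘(ℝ, V) 𝓘(ℝ, E) χ (ξ t) (derivWithin ξ (Icc 0 h) t) := by
    have h3 := congrArg (fun A => A (1 : ℝ)) h1
    rw [mfderivWithin_eq_fderivWithin] at h3
    exact h3
  unfold velocity tangentLift jet
  exact congrArg (fun v => (⟨χ (ξ t), v⟩ : TangentBundle 𝓘(ℝ, E) G)) h2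

/-- The action `∫₀ʰ L(g, ġ) dt`. -/
def action (L : TangentBundle 𝓘(ℝ, E) G → ℝ) (h : ℝ) (g : ℝ → G) : ℝ :=
  ∫ t in (0 : ℝ)..h, L (velocity h g t)

/-- The discrete action `h ∑ⱼ wⱼ L(g(cⱼ h), ġ(cⱼ h))` of the quadrature rule with weights `w` and
nodes `c`. -/
def discreteAction (L : TangentBundle 𝓘(ℝ, E) G → ℝ) {m : ℕ} (w c : Fin m → ℝ)
    (h : ℝ) (g : ℝ → G) : ℝ :=
  h * ∑ j, w j * L (velocity h g (c j * h))

/-- The curves `∑ᵢ ξⁱ φᵢ(t)` in the Lie algebra. -/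
def algebraSpace {ι : Type*} [Fintype ι] (φ : ι → ℝ → ℝ) : Set (ℝ → V) :=
  {ξ | ∃ a : ι → V, ∀ t, ξ t = ∑ i, φ i t • a i}

/-- `C²` curves on `[0,h]` for which `(ξ, ξ̇)` stays in the region `W`. -/
def Admissible (W : Set (V × V)) (h : ℝ) (ξ : ℝ → V) : Prop :=
  ContDiffOn ℝ 2 ξ (Icc 0 h) ∧ ∀ t ∈ Icc 0 h, jet h ξ t ∈ W

/-- The curve `χ ∘ ξ` runs from `g₀` at time `0` to `g₁` at time `h`. -/
def Joins (χ : V → G) (h : ℝ) (ξ : ℝ → V) (g₀ g₁ : G) : Prop :=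
  χ (ξ 0) = g₀ ∧ χ (ξ h) = g₁

/-- `ξ` is a stationary point of the discrete action: the first variation vanishes for all
variations in the approximation space that fix the end points. -/
def IsDiscreteStationary (L : TangentBundle 𝓘(ℝ, E) G → ℝ) (χ : V → G) {m : ℕ}
    (w c : Fin m → ℝ) {ι : Type*} [Fintype ι] (φ : ι → ℝ → ℝ) (h : ℝ) (ξ : ℝ → V) : Prop :=
  ∀ δ ∈ algebraSpace (V := V) φ, δ 0 = 0 → δ h = 0 →
    HasDerivAt (fun s : ℝ => discreteAction L w c h (fun t => χ (ξ t + s • δ t))) 0 0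

/-- The Lagrangian in the coordinates given by `χ`. -/
def coordLagrangian (L : TangentBundle 𝓘(ℝ, E) G → ℝ) (χ : V → G) (z : V × V) : ℝ :=
  L (tangentLift χ z)

/-- The conjugate momentum `∂ℓ/∂v` at `(x, v)`. -/
def momentum (ℓ : V × V → ℝ) (z : V × V) : V →L[ℝ] ℝ :=
  fderiv ℝ (fun v => ℓ (z.1, v)) z.2

/-- The generalized force `∂ℓ/∂x` at `(x, v)`. -/
def force (ℓ : V × V → ℝ) (z : V × V) : V →L[ℝ] ℝ :=
  fderiv ℝ (fun x => ℓ (x, z.2)) z.1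

/-- `χ ∘ η` is a solution on `[0,h]` of the Euler-Lagrange equations of `L`, written in the
coordinates given by `χ`; `η` is `C²` and `(η, η̇)` stays in `W`. -/
def IsExactSolution (L : TangentBundle 𝓘(ℝ, E) G → ℝ) (χ : V → G) (W : Set (V × V))
    (h : ℝ) (η : ℝ → V) : Prop :=
  Admissible W h η ∧ ∀ t ∈ Icc 0 h,
    HasDerivWithinAt (fun s => momentum (coordLagrangian L χ) (jet h η s))
      (force (coordLagrangian L χ) (jet h η t)) (Icc 0 h) t

/-- The exact discrete Lagrangian, the action of the solution `η h g₀ g₁` of the Euler-Lagrange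
equations that joins `g₀` to `g₁` in time `h`. -/
def exactLd (L : TangentBundle 𝓘(ℝ, E) G → ℝ) (χ : V → G) (η : ℝ → G → G → ℝ → V)
    (g₀ g₁ : G) (h : ℝ) : ℝ :=
  action L h (fun t => χ (η h g₀ g₁ t))

/-- The Galerkin discrete Lagrangian, the discrete action of the extremizing curve `ζ h g₀ g₁`. -/
def galerkinLd (L : TangentBundle 𝓘(ℝ, E) G → ℝ) (χ : V → G) {m : ℕ} (w c : Fin m → ℝ)
    (ζ : ℝ → G → G → ℝ → V) (g₀ g₁ : G) (h : ℝ) : ℝ :=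
  discreteAction L w c h (fun t => χ (ζ h g₀ g₁ t))

/-- The partial derivative `D₁ L_d` in coordinates, at `(x, y)`. -/
def partialOne (Ld : G → G → ℝ → ℝ) (χ : V → G) (h : ℝ) (x y : V) : V →L[ℝ] ℝ :=
  fderiv ℝ (fun x' => Ld (χ x') (χ y) h) x

/-- The partial derivative `D₂ L_d` in coordinates, at `(x, y)`. -/
def partialTwo (Ld : G → G → ℝ → ℝ) (χ : V → G) (h : ℝ) (x y : V) : V →L[ℝ] ℝ :=
  fderiv ℝ (fun y' => Ld (χ x) (χ y') h) y

/-- `L_d` is smooth, up to `h = 0`, as a function of the initial point `x`, the mean velocity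
`v` and the step `h`, the end points being `x` and `x + h v`. -/
def SmoothUpToZero (Ld : G → G → ℝ → ℝ) (χ : V → G) (Z : Set (V × V)) (h₀ : ℝ) : Prop :=
  ContDiffOn ℝ ∞
    (fun q : (V × V) × ℝ => Ld (χ q.1.1) (χ (q.1.1 + q.2 • q.1.2)) q.2) (Z ×ˢ Ico 0 h₀)

/-- The Lagrangian is regular on `Z`: its second derivative in the velocities is
nondegenerate. -/
def RegularOn (ℓ : V × V → ℝ) (Z : Set (V × V)) : Prop :=
  ∀ z ∈ Z, Function.Injective (fderiv ℝ (fun v => momentum ℓ (z.1, v)) z.2)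

/-- The phase space map `(x₀, p₀) ↦ (y, p₁)` of the integrator induced by `L_d`, given by
`p₀ = -D₁ L_d(x₀, y, h)` and `p₁ = D₂ L_d(x₀, y, h)`, has one-step error `O(h^k)`, locally
uniformly for initial states `(x₀, v₀)` in `Z`, `p₀` being the momentum of `(x₀, v₀)`.
As the equation for `y` is implicit, the solutions `y = x₀ + h v` with `v` near `v₀` are meant,
and such solutions exist. -/
def PhaseMapErrorBigO (L : TangentBundle 𝓘(ℝ, E) G → ℝ) (χ : V → G) (W Z : Set (V × V))
    (eG : G → G → ℝ) (Ld : G → G → ℝ → ℝ) (k : ℕ) : Prop :=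
  ∀ K ⊆ Z, IsCompact K → ∃ C r h₁ : ℝ, 0 < r ∧ 0 < h₁ ∧ ∀ h ∈ Ioo 0 h₁, ∀ z ∈ K,
    (∃ y : V, ‖y - z.1 - h • z.2‖ ≤ r * h ∧
      -partialOne Ld χ h z.1 y = momentum (coordLagrangian L χ) z) ∧
    ∀ γ : ℝ → V, IsExactSolution L χ W h γ → jet h γ 0 = z →
      ∀ y : V, ‖y - z.1 - h • z.2‖ ≤ r * h →
        -partialOne Ld χ h z.1 y = momentum (coordLagrangian L χ) z →
        ‖y - γ h‖ ≤ C * h ^ k ∧ eG (χ y) (χ (γ h)) ≤ C * h ^ k ∧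
        ‖partialTwo Ld χ h z.1 y - momentum (coordLagrangian L χ) (jet h γ h)‖ ≤ C * h ^ k

/-- The update map `(x₀, x₁) ↦ (x₁, y)` of the integrator induced by `L_d`, given by the discrete
Euler-Lagrange equations `D₂ L_d(x₀, x₁, h) + D₁ L_d(x₁, y, h) = 0`, has one-step error `O(h^k)`
when `x₀ = γ(0)`, `x₁ = γ(h)` lie on an exact solution `γ`, locally uniformly for initial states
`(γ(0), γ̇(0))` in `Z`.  Again the solutions `y = x₁ + h v` with `v` near `γ̇(0)` are meant, and
such solutions exist. -/
def UpdateMapErrorBigO (L : TangentBundle 𝓘(ℝ, E) G → ℝ) (χ : V → G) (W Z : Set (V × V))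
    (eG : G → G → ℝ) (Ld : G → G → ℝ → ℝ) (k : ℕ) : Prop :=
  ∀ K ⊆ Z, IsCompact K → ∃ C r h₁ : ℝ, 0 < r ∧ 0 < h₁ ∧ ∀ h ∈ Ioo 0 h₁, ∀ z ∈ K,
    ∀ γ : ℝ → V, IsExactSolution L χ W (2 * h) γ → jet (2 * h) γ 0 = z →
      (∃ y : V, ‖y - γ h - h • z.2‖ ≤ r * h ∧
        partialTwo Ld χ h (γ 0) (γ h) + partialOne Ld χ h (γ h) y = 0) ∧
      ∀ y : V, ‖y - γ h - h • z.2‖ ≤ r * h →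
        partialTwo Ld χ h (γ 0) (γ h) + partialOne Ld χ h (γ h) y = 0 →
        ‖y - γ (2 * h)‖ ≤ C * h ^ k ∧ eG (χ y) (χ (γ (2 * h))) ≤ C * h ^ k

end Curves

end LieGalerkin

end

/-! The estimate of the discrete Lagrangians is a sandwich. The exact solution minimizes the action,
so `exactLd` is at most the action of the Galerkin curve, which the quadrature bound turns into
`galerkinLd` plus an error. Conversely, the Galerkin curve minimizes the discrete action over the
approximation space, so `galerkinLd` is at most the discrete action of the approximating curve;
quadrature turns this into an action, and `abs_action_sub_action_le` compares that with the action
of the exact solution. Errors of size `h ^ n` in curve and velocity, integrated over a time `h`,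
give `h ^ (n + 1)`.

Closeness of two functions does not by itself give closeness of their derivatives, which define the
integrator. Smoothness up to `h = 0` supplies this. In terms of the initial point `x`, the mean
velocity `v = (y - x) / h` and `k = √h`, Hadamard's lemma gives `L_d = h B` and `L_d^E = h (B + h ^
n R)` with `B`, `R` smooth (`exists_eq_sq_mul`, `exists_eq_sq_pow_mul`), and differentiating `h ^ n
R` in `x` and `v` costs no power of `h`. Since `v` depends on the end points through `1 / h`, the
generated momenta are `-D₁ L_d = ∂ᵥB - h ∂ₓB` and `D₂ L_d = ∂ᵥB`.

Three facts finish the argument. The derivatives of `L_d^E` are the momenta along exact solutions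
(`partial_exactLd_eq`): perturbing a solution by affine variations gives an upper bound for `L_d^E`
that touches it, so the derivatives agree. At `h = 0` the function `B` is the Lagrangian
(`eq_lagrangian_of_action_eq`), so the nondegenerate second derivative makes `v ↦ ∂ᵥB - h ∂ₓB`
invertible near the initial velocity, uniformly on compact sets (`exists_uniform_inverse`). Hence
discrete and exact mean velocities, which solve equations differing by `O(h ^ n)`, differ by `O(h ^
n)`, and the end points, `h` times as far apart, by `O(h ^ (n + 1))`. The final momenta gain the
same extra power because the initial momentum is shared. -/

namespace LieGalerkin

open Filter Topology MeasureTheory Metric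

/-! ### Continuity and differentiation under the integral sign. -/

section ParametricIntegral

/-- A function continuous on `S × [a, b]` is bounded on `N × [a, b]` for a neighbourhood `N` of a
given point of the open set `S`. -/
theorem eventually_norm_le_of_continuousOn_prod_Icc {X F : Type*} [NormedAddCommGroup X]
    [NormedAddCommGroup F] {g : X → ℝ → F} {S : Set X} (hS : IsOpen S)
    {a b : ℝ} (hg : ContinuousOn (Function.uncurry g) (S ×ˢ Icc a b)) {x₀ : X} (hx₀ : x₀ ∈ S) :
    ∃ M, ∀ᶠ x in 𝓝 x₀, ∀ t ∈ Icc a b, ‖g x t‖ ≤ M := by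
  have h1 : ContinuousOn (fun t => g x₀ t) (Icc a b) :=
    hg.comp (by fun_prop : ContinuousOn (fun t => (x₀, t)) (Icc a b)) fun t ht => ⟨hx₀, ht⟩
  obtain ⟨M, hM⟩ := isCompact_Icc.exists_bound_of_continuousOn h1
  refine ⟨M + 1, ?_⟩
  have := isCompact_Icc.eventually_forall_of_forall_eventually (K := Icc a b) (x₀ := x₀)
    (P := fun x t => t ∈ Icc a b → ‖g x t‖ ≤ M + 1) ?_
  · filter_upwards [this] with x hx t ht using hx t ht ht
  intro t ht
  have h2 := (hg (x₀, t) ⟨hx₀, ht⟩).norm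
  have h3 : ∀ᶠ z in 𝓝[S ×ˢ Icc a b] (x₀, t), ‖Function.uncurry g z‖ < M + 1 :=
    h2.eventually_lt tendsto_const_nhds (by simpa using (hM t ht).trans_lt (lt_add_one M))
  rw [eventually_nhdsWithin_iff] at h3
  filter_upwards [h3, (hS.prod isOpen_univ).mem_nhds (⟨hx₀, mem_univ t⟩ : (x₀, t) ∈ S ×ˢ univ)]
    with z hz hzS hzt
  exact (hz ⟨hzS.1, hzt⟩).le

theorem continuousOn_integral_of_continuousOn {X F : Type*} [NormedAddCommGroup X]
    [NormedAddCommGroup F] [NormedSpace ℝ F] {f : X → ℝ → F} {S : Set X} (hS : IsOpen S)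
    {a b : ℝ} (hab : a ≤ b) (hf : ContinuousOn (Function.uncurry f) (S ×ˢ Icc a b)) :
    ContinuousOn (fun x => ∫ t in a..b, f x t) S := by
  intro x₀ hx₀
  obtain ⟨M, hM⟩ := eventually_norm_le_of_continuousOn_prod_Icc hS hf hx₀
  have hsub : uIoc a b ⊆ Icc a b := by rw [uIoc_of_le hab]; exact Ioc_subset_Icc_self
  refine (intervalIntegral.continuousAt_of_dominated_interval (bound := fun _ => M) ?_ ?_ ?_
    ?_).continuousWithinAt
  · filter_upwards [hS.mem_nhds hx₀] with x hx
    refine ContinuousOn.aestronglyMeasurable ?_ measurableSet_uIoc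
    exact hf.comp (by fun_prop : ContinuousOn (fun t => (x, t)) (uIoc a b))
      fun t ht => ⟨hx, hsub ht⟩
  · filter_upwards [hM] with x hx
    exact Eventually.of_forall fun t ht => hx t (hsub ht)
  · exact intervalIntegrable_const
  · refine Eventually.of_forall fun t ht => ?_
    have : ContinuousOn (fun x => f x t) S :=
      hf.comp (by fun_prop : ContinuousOn (fun x => (x, t)) S) fun x hx => ⟨hx, hsub ht⟩
    exact this.continuousAt (hS.mem_nhds hx₀)

variable {X F : Type*} [NormedAddCommGroup X] [NormedSpace ℝ X]
  [NormedAddCommGroup F] [NormedSpace ℝ F]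

theorem hasFDerivAt_integral_of_continuousOn {f : X → ℝ → F} {f' : X → ℝ → X →L[ℝ] F}
    {S : Set X} (hS : IsOpen S) {a b : ℝ} (hab : a ≤ b)
    (hf : ∀ x ∈ S, ContinuousOn (f x) (Icc a b))
    (hf' : ContinuousOn (Function.uncurry f') (S ×ˢ Icc a b))
    (hd : ∀ x ∈ S, ∀ t ∈ Icc a b, HasFDerivAt (fun x => f x t) (f' x t) x)
    {x₀ : X} (hx₀ : x₀ ∈ S) :
    HasFDerivAt (fun x => ∫ t in a..b, f x t) (∫ t in a..b, f' x₀ t) x₀ := by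
  obtain ⟨M, hM⟩ := eventually_norm_le_of_continuousOn_prod_Icc hS hf' hx₀
  have hsub : uIoc a b ⊆ Icc a b := by rw [uIoc_of_le hab]; exact Ioc_subset_Icc_self
  have hmeas : ∀ x ∈ S, AEStronglyMeasurable (f x) (volume.restrict (uIoc a b)) := fun x hx =>
    ((hf x hx).mono hsub).aestronglyMeasurable measurableSet_uIoc
  have h1 : ContinuousOn (f' x₀) (Icc a b) :=
    hf'.comp (by fun_prop : ContinuousOn (fun t => (x₀, t)) (Icc a b)) fun t ht => ⟨hx₀, ht⟩
  refine intervalIntegral.hasFDerivAt_integral_of_dominated_of_fderiv_le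
    (s := {x | x ∈ S ∧ ∀ t ∈ Icc a b, ‖f' x t‖ ≤ M}) (bound := fun _ => M)
    (inter_mem (hS.mem_nhds hx₀) hM) ?_ ?_ ?_ ?_ ?_ ?_
  · filter_upwards [hS.mem_nhds hx₀] with x hx using hmeas x hx
  · exact ((hf x₀ hx₀).mono (by rw [uIcc_of_le hab])).intervalIntegrable
  · exact (h1.mono hsub).aestronglyMeasurable measurableSet_uIoc
  · exact Eventually.of_forall fun t ht x hx => hx.2 t (hsub ht)
  · exact intervalIntegrable_const
  · exact Eventually.of_forall fun t ht x hx => hd x hx.1 t (hsub ht)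

/-- The derivative of a parametric integral of a continuously differentiable function. -/
theorem hasFDerivAt_integral_of_contDiffOn {f : X × ℝ → F} {Ω : Set (X × ℝ)} (hΩ : IsOpen Ω)
    (hf : ContDiffOn ℝ 1 f Ω) {S : Set X} (hS : IsOpen S) {a b : ℝ} (hab : a ≤ b)
    (hSΩ : S ×ˢ Icc a b ⊆ Ω) {x₀ : X} (hx₀ : x₀ ∈ S) :
    HasFDerivAt (fun x => ∫ t in a..b, f (x, t))
      (∫ t in a..b, (fderiv ℝ f (x₀, t)).comp (ContinuousLinearMap.inl ℝ X ℝ)) x₀ := by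
  refine hasFDerivAt_integral_of_continuousOn (f := fun x t => f (x, t))
    (f' := fun x t => (fderiv ℝ f (x, t)).comp (ContinuousLinearMap.inl ℝ X ℝ)) hS hab
    ?_ ?_ ?_ hx₀
  · intro x hx
    exact hf.continuousOn.comp (by fun_prop : ContinuousOn (fun t => (x, t)) (Icc a b))
      fun t ht => hSΩ ⟨hx, ht⟩
  · have h1 := (hf.continuousOn_fderiv_of_isOpen hΩ le_rfl).mono hSΩ
    exact h1.clm_comp continuousOn_const
  · intro x hx t ht
    have h1 : HasFDerivAt f (fderiv ℝ f (x, t)) (x, t) :=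
      ((hf.differentiableOn one_ne_zero).differentiableAt
        (hΩ.mem_nhds (hSΩ ⟨hx, ht⟩))).hasFDerivAt
    exact h1.comp x (hasFDerivAt_prodMk_left x t)

end ParametricIntegral

/-! ### Smooth parametric integrals and division by powers of the parameter. -/

section Smoothness

universe u

variable {X : Type u} [NormedAddCommGroup X] [NormedSpace ℝ X]

/-- Induction on the order of smoothness: the derivative of the integral is the integral of the
partial derivative. The target `F` is quantified inside the induction because differentiation
replaces it by `X →L[ℝ] F`, which stays in the universe of `X`. -/
theorem contDiffOn_integral_nat (m : ℕ) : ∀ {F : Type u} [NormedAddCommGroup F] [NormedSpace ℝ F]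
    {f : X × ℝ → F} {Ω : Set (X × ℝ)}, IsOpen Ω → ContDiffOn ℝ m f Ω →
    ∀ {S : Set X}, IsOpen S → ∀ {a b : ℝ}, a ≤ b → S ×ˢ Icc a b ⊆ Ω →
    ContDiffOn ℝ m (fun x => ∫ t in a..b, f (x, t)) S := by
  induction m with
  | zero =>
    intro F _ _ f Ω hΩ hf S hS a b hab hSΩ
    rw [Nat.cast_zero, contDiffOn_zero] at hf ⊢
    exact continuousOn_integral_of_continuousOn (f := fun x t => f (x, t)) hS hab (hf.mono hSΩ)
  | succ m ih =>
    intro F _ _ f Ω hΩ hf S hS a b hab hSΩ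
    have hd : ∀ x ∈ S, HasFDerivAt (fun x => ∫ t in a..b, f (x, t))
        (∫ t in a..b, (fderiv ℝ f (x, t)).comp (ContinuousLinearMap.inl ℝ X ℝ)) x := fun x hx =>
      hasFDerivAt_integral_of_contDiffOn hΩ (hf.of_le (by norm_cast; omega)) hS hab hSΩ hx
    push_cast at hf ⊢
    rw [contDiffOn_succ_iff_fderiv_of_isOpen hΩ] at hf
    rw [contDiffOn_succ_iff_fderiv_of_isOpen hS]
    refine ⟨fun x hx => (hd x hx).differentiableAt.differentiableWithinAt, by simp, ?_⟩
    refine (ih (f := fun p => (fderiv ℝ f p).comp (ContinuousLinearMap.inl ℝ X ℝ)) hΩ ?_ hS hab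
      hSΩ).congr fun x hx => (hd x hx).fderiv
    exact hf.2.2.clm_comp contDiffOn_const

/-- Parametric integrals of smooth functions are smooth. -/
theorem contDiffOn_integral {f : X × ℝ → ℝ} {Ω : Set (X × ℝ)} (hΩ : IsOpen Ω)
    (hf : ContDiffOn ℝ ∞ f Ω) {S : Set X} (hS : IsOpen S) {a b : ℝ} (hab : a ≤ b)
    (hSΩ : S ×ˢ Icc a b ⊆ Ω) :
    ContDiffOn ℝ ∞ (fun x => ∫ t in a..b, f (x, t)) S := by
  have hd : ∀ x ∈ S, HasFDerivAt (fun x => ∫ t in a..b, f (x, t))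
      (∫ t in a..b, (fderiv ℝ f (x, t)).comp (ContinuousLinearMap.inl ℝ X ℝ)) x := fun x hx =>
    hasFDerivAt_integral_of_contDiffOn hΩ (hf.of_le (by simp)) hS hab hSΩ hx
  -- One derivative is taken first, so that the values lie in `X →L[ℝ] ℝ`, in the universe of `X`,
  -- as `contDiffOn_integral_nat` demands.
  rw [contDiffOn_infty_iff_fderiv_of_isOpen hS]
  refine ⟨fun x hx => (hd x hx).differentiableAt.differentiableWithinAt, ?_⟩
  rw [contDiffOn_infty]
  intro m
  refine (contDiffOn_integral_nat m
    (f := fun p => (fderiv ℝ f p).comp (ContinuousLinearMap.inl ℝ X ℝ)) hΩ ?_ hS hab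
    hSΩ).congr fun x hx => (hd x hx).fderiv
  exact ((hf.fderiv_of_isOpen hΩ (m := m) (by norm_cast; exact le_top)).clm_comp contDiffOn_const)

/-- Hadamard's lemma: a smooth function that vanishes for `k = 0` is divisible by `k`. -/
theorem exists_eq_mul_of_forall_eq_zero {f : X × ℝ → ℝ} {S : Set X} (hS : IsOpen S) {a : ℝ}
    (hf : ContDiffOn ℝ ∞ f (S ×ˢ Ioo (-a) a)) (h0 : ∀ x ∈ S, f (x, 0) = 0) :
    ∃ g : X × ℝ → ℝ, ContDiffOn ℝ ∞ g (S ×ˢ Ioo (-a) a) ∧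
      ∀ x ∈ S, ∀ k ∈ Ioo (-a) a, f (x, k) = k * g (x, k) := by
  have hO : IsOpen (S ×ˢ Ioo (-a) a) := hS.prod isOpen_Ioo
  set D : X × ℝ → ℝ := fun p => fderiv ℝ f p (0, 1) with hD
  have hDs : ContDiffOn ℝ ∞ D (S ×ˢ Ioo (-a) a) :=
    (hf.fderiv_of_isOpen hO (by simp)).clm_apply contDiffOn_const
  set σ : (X × ℝ) × ℝ → X × ℝ := fun q => (q.1.1, q.2 * q.1.2) with hσ
  have hσs : ContDiff ℝ ∞ σ := by fun_prop
  have hseg : ∀ k ∈ Ioo (-a) a, ∀ s ∈ Icc (0 : ℝ) 1, s * k ∈ Ioo (-a) a := by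
    intro k hk s hs
    rw [mem_Ioo, ← abs_lt] at hk ⊢
    rw [abs_mul, abs_of_nonneg hs.1]
    exact (mul_le_of_le_one_left (abs_nonneg k) hs.2).trans_lt hk
  -- The quotient is the average of `∂f/∂k` along the segment from `(x, 0)` to `(x, k)`.
  refine ⟨fun p => ∫ s in (0 : ℝ)..1, D (σ (p, s)), ?_, ?_⟩
  · refine contDiffOn_integral (f := fun q => D (σ q)) (hO.preimage hσs.continuous)
      (hDs.comp hσs.contDiffOn (fun q hq => hq)) hO zero_le_one ?_
    rintro ⟨⟨x, k⟩, s⟩ ⟨⟨hx, hk⟩, hs⟩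
    exact ⟨hx, hseg k hk s hs⟩
  · intro x hx k hk
    have hder : ∀ s ∈ uIcc (0 : ℝ) 1,
        HasDerivAt (fun s => f (x, s * k)) (k * D (σ ((x, k), s))) s := by
      intro s hs
      rw [uIcc_of_le zero_le_one] at hs
      have hm : (x, s * k) ∈ S ×ˢ Ioo (-a) a := ⟨hx, hseg k hk s hs⟩
      have h1 : HasFDerivAt f (fderiv ℝ f (x, s * k)) (x, s * k) :=
        ((hf.differentiableOn (by simp)).differentiableAt (hO.mem_nhds hm)).hasFDerivAt
      have h2 : HasDerivAt (fun s : ℝ => (x, s * k)) ((0 : X), k) s :=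
        (hasDerivAt_const s x).prodMk (by simpa using (hasDerivAt_id s).mul_const k)
      have h3 := h1.comp_hasDerivAt s h2
      have h4 : ((0 : X), k) = k • ((0 : X), (1 : ℝ)) := by simp
      rw [h4, map_smul, smul_eq_mul] at h3
      exact h3
    have hcont : ContinuousOn (fun s => k * D (σ ((x, k), s))) (uIcc 0 1) := by
      refine continuousOn_const.mul (hDs.continuousOn.comp
        (hσs.continuous.comp (by fun_prop : Continuous fun s : ℝ => ((x, k), s))).continuousOn ?_)
      intro s hs
      rw [uIcc_of_le zero_le_one] at hs
      exact ⟨hx, hseg k hk s hs⟩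
    have h5 := intervalIntegral.integral_eq_sub_of_hasDerivAt hder hcont.intervalIntegrable
    simp only [one_mul, zero_mul, h0 x hx, sub_zero] at h5
    rw [← h5, intervalIntegral.integral_const_mul]

/-- A smooth function of size `O(k^N)` is divisible by `k^N`. -/
theorem exists_eq_pow_mul_of_abs_le {f : X × ℝ → ℝ} {S : Set X} (hS : IsOpen S) {a : ℝ}
    (ha : 0 < a) (hf : ContDiffOn ℝ ∞ f (S ×ˢ Ioo (-a) a)) {C : ℝ} {N : ℕ}
    (hC : ∀ x ∈ S, ∀ k ∈ Ioo (-a) a, k ≠ 0 → |f (x, k)| ≤ C * |k| ^ N) :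
    ∃ g : X × ℝ → ℝ, ContDiffOn ℝ ∞ g (S ×ˢ Ioo (-a) a) ∧
      ∀ x ∈ S, ∀ k ∈ Ioo (-a) a, f (x, k) = k ^ N * g (x, k) := by
  induction N generalizing f with
  | zero => exact ⟨f, hf, by simp⟩
  | succ N ih =>
    -- The bound is assumed only for `k ≠ 0`; continuity carries it to `k = 0`. The quotient by `k`
    -- then satisfies the bound with one power less.
    have h0 : ∀ x ∈ S, f (x, 0) = 0 := by
      intro x hx
      have hmem : (0 : ℝ) ∈ Ioo (-a) a := ⟨by linarith, ha⟩
      have hc : ContinuousOn (fun k => f (x, k)) (Ioo (-a) a) :=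
        hf.continuousOn.comp (by fun_prop : ContinuousOn (fun k => (x, k)) (Ioo (-a) a))
          fun k hk => ⟨hx, hk⟩
      have h1 : Tendsto (fun k => |f (x, k)|) (𝓝[≠] 0) (𝓝 |f (x, 0)|) :=
        ((hc.continuousAt (isOpen_Ioo.mem_nhds hmem)).abs.tendsto).mono_left nhdsWithin_le_nhds
      have h2 : Tendsto (fun k : ℝ => C * |k| ^ (N + 1)) (𝓝[≠] 0) (𝓝 (C * |0| ^ (N + 1))) :=
        (by fun_prop : Continuous fun k : ℝ => C * |k| ^ (N + 1)).continuousAt.tendsto.mono_left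
          nhdsWithin_le_nhds
      have h3 : |f (x, 0)| ≤ C * |0| ^ (N + 1) := by
        refine le_of_tendsto_of_tendsto h1 h2 ?_
        filter_upwards [self_mem_nhdsWithin, nhdsWithin_le_nhds (isOpen_Ioo.mem_nhds hmem)]
          with k hk hk'
        exact hC x hx k hk' hk
      simpa using h3
    obtain ⟨g, hg, hfg⟩ := exists_eq_mul_of_forall_eq_zero hS hf h0
    obtain ⟨g', hg', hgg'⟩ := ih hg fun x hx k hk hk0 => by
      have h1 := hC x hx k hk hk0
      rw [hfg x hx k hk, abs_mul, pow_succ] at h1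
      have h2 : 0 < |k| := abs_pos.2 hk0
      nlinarith
    exact ⟨g', hg', fun x hx k hk => by rw [hfg x hx k hk, hgg' x hx k hk]; ring⟩

end Smoothness

/-! ### A quantitative inverse function theorem, uniform on compact sets. -/

section UniformInverse

variable {V : Type*} [NormedAddCommGroup V] [InnerProductSpace ℝ V] [FiniteDimensional ℝ V]

/-- By Riesz, `V` and its dual have the same finite dimension. -/
theorem isInvertible_of_injective_dual {A : V →L[ℝ] V →L[ℝ] ℝ} (hA : Function.Injective A) :
    A.IsInvertible := by
  have hdim : Module.finrank ℝ V = Module.finrank ℝ (V →L[ℝ] ℝ) := by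
    rw [(InnerProductSpace.toDual ℝ V).toLinearEquiv.finrank_eq]
  exact ⟨(LinearEquiv.ofInjectiveOfFinrankEq A.toLinearMap hA hdim).toContinuousLinearEquiv,
    by ext; rfl⟩

/-- Invertible derivatives depending continuously on parameters in a compact set have uniformly
bounded inverses. -/
theorem exists_norm_inverse_le {Y : Type*} [TopologicalSpace Y] {K : Set Y} (hK : IsCompact K)
    {T : Y → V →L[ℝ] V →L[ℝ] ℝ} (hT : ContinuousOn T K)
    (hinv : ∀ y ∈ K, (T y).IsInvertible) :
    ∃ κ, 0 < κ ∧ ∀ y ∈ K, ‖(T y).inverse‖ ≤ κ := by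
  have h1 : ContinuousOn (fun y => (T y).inverse) K := fun y hy =>
    ((hinv y hy).contDiffAt_map_inverse (𝕜 := ℝ) (n := 0)).continuousAt.comp_continuousWithinAt
      (hT y hy)
  obtain ⟨κ, hκ⟩ := hK.exists_bound_of_continuousOn (f := fun y => (T y).inverse) h1
  exact ⟨max κ 1, by positivity, fun y hy => (hκ y hy).trans (le_max_left _ _)⟩

/-- The partial derivative with respect to the second variable. -/
noncomputable def derivSnd {F : Type*} [NormedAddCommGroup F] [NormedSpace ℝ F]
    (f : (V × V) × ℝ → F)
    (q : (V × V) × ℝ) : V →L[ℝ] F :=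
  (fderiv ℝ f q).comp ((ContinuousLinearMap.inl ℝ (V × V) ℝ).comp (ContinuousLinearMap.inr ℝ V V))

/-- The partial derivative with respect to the first variable. -/
noncomputable def derivFst {F : Type*} [NormedAddCommGroup F] [NormedSpace ℝ F]
    (f : (V × V) × ℝ → F)
    (q : (V × V) × ℝ) : V →L[ℝ] F :=
  (fderiv ℝ f q).comp ((ContinuousLinearMap.inl ℝ (V × V) ℝ).comp (ContinuousLinearMap.inl ℝ V V))

omit [FiniteDimensional ℝ V] in
theorem hasFDerivAt_derivSnd {F : Type*} [NormedAddCommGroup F] [NormedSpace ℝ F]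
    {f : (V × V) × ℝ → F} {x v : V} {k : ℝ} (hf : DifferentiableAt ℝ f ((x, v), k)) :
    HasFDerivAt (fun u => f ((x, u), k)) (derivSnd f ((x, v), k)) v := by
  have h1 : HasFDerivAt (fun u : V => ((x, u), k))
      ((ContinuousLinearMap.inl ℝ (V × V) ℝ).comp (ContinuousLinearMap.inr ℝ V V)) v :=
    HasFDerivAt.comp (g := fun z : V × V => (z, k)) v (hasFDerivAt_prodMk_left (x, v) k)
      (hasFDerivAt_prodMk_right x v)
  exact HasFDerivAt.comp (g := f) v hf.hasFDerivAt h1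

/-- A family of maps with invertible derivatives at `k = 0` is invertible on balls of a radius
that is uniform on compact sets. -/
theorem exists_uniform_inverse {Z : Set (V × V)} (hZ : IsOpen Z) {a : ℝ} (ha : 0 < a)
    {Ψ : (V × V) × ℝ → V →L[ℝ] ℝ} (hΨ : ContDiffOn ℝ 1 Ψ (Z ×ˢ Ioo (-a) a))
    (hinj : ∀ z ∈ Z, Function.Injective (derivSnd Ψ (z, 0)))
    {K : Set (V × V)} (hK : IsCompact K) (hKZ : K ⊆ Z) {r₀ : ℝ} (hr₀ : 0 < r₀) :
    ∃ C r k₁ ρ : ℝ, 0 < C ∧ 0 < r ∧ r ≤ r₀ ∧ 0 < k₁ ∧ k₁ ≤ a ∧ 0 < ρ ∧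
      ∀ z ∈ K, ∀ k, |k| < k₁ →
        (∀ u u', ‖u - z.2‖ ≤ r → ‖u' - z.2‖ ≤ r →
          ‖u - u'‖ ≤ C * ‖Ψ ((z.1, u), k) - Ψ ((z.1, u'), k)‖) ∧
        ∀ p, ‖p - Ψ (z, 0)‖ ≤ ρ → ∃ u, ‖u - z.2‖ ≤ r ∧ Ψ ((z.1, u), k) = p := by
  have hO : IsOpen (Z ×ˢ Ioo (-a) a) := hZ.prod isOpen_Ioo
  have h0 : (0 : ℝ) ∈ Ioo (-a) a := ⟨by linarith, ha⟩
  have hT : ContinuousOn (derivSnd Ψ) (Z ×ˢ Ioo (-a) a) :=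
    (hΨ.continuousOn_fderiv_of_isOpen hO le_rfl).clm_comp continuousOn_const
  obtain ⟨κ, hκ0, hκ⟩ := exists_norm_inverse_le (T := fun z => derivSnd Ψ (z, 0)) hK
    (hT.comp (by fun_prop : ContinuousOn (fun z => (z, (0 : ℝ))) K) fun z hz => ⟨hKZ hz, h0⟩)
    fun z hz => isInvertible_of_injective_dual (hinj z (hKZ hz))
  obtain ⟨r₂, hr₂, hr₂Z⟩ := hK.exists_cthickening_subset_open hZ hKZ
  set Q : Set ((V × V) × ℝ) := cthickening r₂ K ×ˢ Icc (-(a / 2)) (a / 2) with hQ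
  have hQc : IsCompact Q := (hK.cthickening).prod isCompact_Icc
  have hQO : Q ⊆ Z ×ˢ Ioo (-a) a := by
    rintro ⟨z, k⟩ ⟨hz, hk⟩
    exact ⟨hr₂Z hz, by linarith [hk.1], by linarith [hk.2]⟩
  have huT := hQc.uniformContinuousOn_of_continuous (hT.mono hQO)
  have huΨ := hQc.uniformContinuousOn_of_continuous (hΨ.continuousOn.mono hQO)
  rw [Metric.uniformContinuousOn_iff] at huT huΨ
  -- Within `δ` of `(z, 0)` the partial derivative stays within `1 / (2κ)` of its value `A` at `(z,
  -- 0)`. As `A⁻¹` has norm at most `κ`, this is half of what injectivity and surjectivity can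
  -- tolerate.
  obtain ⟨δ, hδ, hδT⟩ := huT (1 / (2 * κ)) (by positivity)
  set r := min (min r₂ (δ / 2)) r₀ with hr
  have hr0 : 0 < r := by positivity
  have hrr₂ : r ≤ r₂ := (min_le_left _ _).trans (min_le_left _ _)
  have hrδ : r < δ := by
    have : r ≤ δ / 2 := (min_le_left _ _).trans (min_le_right _ _)
    linarith
  obtain ⟨δ', hδ', hδΨ⟩ := huΨ (r / (4 * κ)) (by positivity)
  have hmem : ∀ z ∈ K, ∀ u, ‖u - z.2‖ ≤ r → (z.1, u) ∈ cthickening r₂ K ∧ dist (z.1, u) z ≤ r := by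
    intro z hz u hu
    have h1 : dist (z.1, u) z ≤ r := by
      rw [Prod.dist_eq, dist_self, dist_eq_norm]
      exact max_le hr0.le hu
    exact ⟨mem_cthickening_of_dist_le _ z _ _ hz (h1.trans hrr₂), h1⟩
  refine ⟨2 * κ, r, min (a / 2) (min δ δ'), r / (4 * κ), by positivity, hr0, min_le_right _ _,
    by positivity, (min_le_left _ _).trans (by linarith), by positivity, ?_⟩
  intro z hz k hk
  have hk2 : |k| < a / 2 := hk.trans_le (min_le_left _ _)
  have hkδ : |k| < δ := hk.trans_le ((min_le_right _ _).trans (min_le_left _ _))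
  have hkδ' : |k| < δ' := hk.trans_le ((min_le_right _ _).trans (min_le_right _ _))
  have hkI : k ∈ Icc (-(a / 2)) (a / 2) := abs_le.1 hk2.le
  have h0I : (0 : ℝ) ∈ Icc (-(a / 2)) (a / 2) := ⟨by linarith, by linarith⟩
  have hzQ : (z, (0 : ℝ)) ∈ Q := ⟨self_subset_cthickening K hz, h0I⟩
  obtain ⟨A, hA⟩ := isInvertible_of_injective_dual (hinj z (hKZ hz))
  have hAκ : ∀ p, ‖A.symm p‖ ≤ κ * ‖p‖ := by
    have h1 := hκ z hz
    simp only [← hA, ContinuousLinearMap.inverse_equiv] at h1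
    exact fun p => (A.symm : (V →L[ℝ] ℝ) →L[ℝ] V).le_of_opNorm_le h1 p
  have happ : ∀ u ∈ closedBall z.2 r, ∀ u' ∈ closedBall z.2 r,
      ‖Ψ ((z.1, u), k) - Ψ ((z.1, u'), k) - A (u - u')‖ ≤ 1 / (2 * κ) * ‖u - u'‖ := by
    intro u hu u' hu'
    refine (convex_closedBall z.2 r).norm_image_sub_le_of_norm_hasFDerivWithin_le'
      (f := fun u => Ψ ((z.1, u), k)) (f' := fun u => derivSnd Ψ ((z.1, u), k))
      (φ := (A : V →L[ℝ] V →L[ℝ] ℝ)) ?_ ?_ hu' hu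
    · intro y hy
      rw [mem_closedBall, dist_eq_norm] at hy
      have hyQ : ((z.1, y), k) ∈ Q := ⟨(hmem z hz y hy).1, hkI⟩
      exact (hasFDerivAt_derivSnd ((hΨ.differentiableOn one_ne_zero).differentiableAt
        (hO.mem_nhds (hQO hyQ)))).hasFDerivWithinAt
    · intro y hy
      rw [mem_closedBall, dist_eq_norm] at hy
      have hyQ : ((z.1, y), k) ∈ Q := ⟨(hmem z hz y hy).1, hkI⟩
      rw [hA, ← dist_eq_norm]
      refine (hδT _ hyQ _ hzQ ?_).le
      rw [Prod.dist_eq]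
      refine max_lt ((hmem z hz y hy).2.trans_lt hrδ) ?_
      rwa [Real.dist_eq, sub_zero]
  refine ⟨?_, ?_⟩
  · intro u u' hu hu'
    have h1 := happ u (by rwa [mem_closedBall, dist_eq_norm]) u'
      (by rwa [mem_closedBall, dist_eq_norm])
    have h2 : ‖u - u'‖ ≤ κ * ‖A (u - u')‖ := by simpa using hAκ (A (u - u'))
    have h3 : ‖A (u - u')‖ ≤ ‖Ψ ((z.1, u), k) - Ψ ((z.1, u'), k)‖ + 1 / (2 * κ) * ‖u - u'‖ := by
      have := norm_sub_norm_le (A (u - u')) (Ψ ((z.1, u), k) - Ψ ((z.1, u'), k))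
      rw [norm_sub_rev (A (u - u'))] at this
      linarith
    have h4 : κ * ‖A (u - u')‖ ≤
        κ * ‖Ψ ((z.1, u), k) - Ψ ((z.1, u'), k)‖ + 1 / 2 * ‖u - u'‖ := by
      refine (mul_le_mul_of_nonneg_left h3 hκ0.le).trans_eq ?_
      field_simp
    linarith
  · intro p hp
    set N : (A : V →L[ℝ] V →L[ℝ] ℝ).NonlinearRightInverse :=
      { toFun := A.symm
        nnnorm := ⟨κ, hκ0.le⟩
        bound' := hAκ
        right_inv' := fun y => by simp } with hN
    have hal : ApproximatesLinearOn (fun u => Ψ ((z.1, u), k)) (A : V →L[ℝ] V →L[ℝ] ℝ)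
        (closedBall z.2 r) (⟨1 / (2 * κ), by positivity⟩ : NNReal) :=
      fun u hu u' hu' => happ u hu u' hu'
    have hs := hal.surjOn_closedBall_of_nonlinearRightInverse N hr0.le subset_rfl
    have hpm : p ∈ closedBall (Ψ ((z.1, z.2), k)) (((N.nnnorm : ℝ)⁻¹ - 1 / (2 * κ)) * r) := by
      rw [mem_closedBall, dist_eq_norm]
      -- The image of the ball of radius `r` contains a ball of radius `r / (2κ)`. One half of it
      -- absorbs the change of the centre from `k = 0` to `k`; the other half is the `ρ` left for
      -- `p`.
      have h1 : ((N.nnnorm : ℝ)⁻¹ - 1 / (2 * κ)) * r = r / (4 * κ) + r / (4 * κ) := by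
        have : (N.nnnorm : ℝ) = κ := rfl
        rw [this]; field_simp; ring
      have h2 : ‖Ψ (z, 0) - Ψ (z, k)‖ ≤ r / (4 * κ) := by
        rw [← dist_eq_norm]
        refine (hδΨ _ hzQ (z, k) ⟨hzQ.1, hkI⟩ ?_).le
        rw [Prod.dist_eq, dist_self]
        refine max_lt hδ' ?_
        rwa [dist_comm, Real.dist_eq, sub_zero]
      rw [h1]
      calc ‖p - Ψ (z, k)‖ = ‖(p - Ψ (z, 0)) + (Ψ (z, 0) - Ψ (z, k))‖ := by abel_nf
        _ ≤ _ := norm_add_le_of_le hp h2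
    obtain ⟨u, hu, hup⟩ := hs hpm
    exact ⟨u, by rwa [mem_closedBall, dist_eq_norm] at hu, hup⟩

end UniformInverse

/-! ### The natural chart, the Lagrangian in coordinates and the action. -/

section Chart

variable {E : Type*} [NormedAddCommGroup E] [NormedSpace ℝ E]
  {V : Type*} [NormedAddCommGroup V] [InnerProductSpace ℝ V]
  {G : Type*} [TopologicalSpace G] [ChartedSpace E G]

theorem contMDiffOn_natChart [Group G] [LieGroup 𝓘(ℝ, E) ∞ G]
    (e : V ≃L[ℝ] GroupLieAlgebra 𝓘(ℝ, E) G) (Φ : GroupLieAlgebra 𝓘(ℝ, E) G → G) (b : G)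
    {U : Set V}
    (hΦ : IsLocalDiffeomorphOn 𝓘(ℝ, V) 𝓘(ℝ, E) ∞ (fun x : V => Φ (e x)) U) :
    ContMDiffOn 𝓘(ℝ, V) 𝓘(ℝ, E) ∞ (natChart e Φ b) U :=
  (contMDiff_mul_left (I := 𝓘(ℝ, E)) (n := ∞) (a := b)).comp_contMDiffOn hΦ.contMDiffOn

theorem contMDiffOn_tangentLift [IsManifold 𝓘(ℝ, E) ∞ G] {χ : V → G} {U : Set V} (hU : IsOpen U)
    (hχ : ContMDiffOn 𝓘(ℝ, V) 𝓘(ℝ, E) ∞ χ U) :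
    ContMDiffOn 𝓘(ℝ, V × V) 𝓘(ℝ, E).tangent ∞
      (tangentLift χ : V × V → TangentBundle 𝓘(ℝ, E) G) (U ×ˢ univ) := by
  have : IsManifold 𝓘(ℝ, E) 1 G := IsManifold.of_le (n := ∞) (by simp)
  have h1 := hχ.contMDiffOn_tangentMapWithin (m := ∞) (by simp) hU.uniqueMDiffOn
  have h2 : ContMDiff 𝓘(ℝ, V × V) 𝓘(ℝ, V).tangent ∞
      (fun z : V × V => (⟨z.1, z.2⟩ : TangentBundle 𝓘(ℝ, V) V)) := by
    intro z
    refine (Bundle.contMDiffAt_totalSpace (f := fun z : V × V =>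
      (⟨z.1, z.2⟩ : TangentBundle 𝓘(ℝ, V) V))).2 ⟨contDiff_fst.contMDiff.contMDiffAt, ?_⟩
    refine contDiff_snd.contMDiff.contMDiffAt.congr_of_eventuallyEq
      (Eventually.of_forall fun y => ?_)
    simp
  refine (h1.comp h2.contMDiffOn (fun z hz => hz.1)).congr fun z hz => ?_
  simp only [Function.comp_apply, tangentMapWithin, tangentLift,
    mfderivWithin_of_isOpen hU hz.1]

theorem contDiffOn_coordLagrangian [IsManifold 𝓘(ℝ, E) ∞ G] {χ : V → G} {U : Set V}
    (hU : IsOpen U) (hχ : ContMDiffOn 𝓘(ℝ, V) 𝓘(ℝ, E) ∞ χ U)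
    {L : TangentBundle 𝓘(ℝ, E) G → ℝ} {k : ℕ∞}
    (hL : ContMDiff 𝓘(ℝ, E).tangent 𝓘(ℝ, ℝ) k L) :
    ContDiffOn ℝ k (coordLagrangian L χ) (U ×ˢ univ) := by
  rw [← contMDiffOn_iff_contDiffOn]
  exact hL.comp_contMDiffOn ((contMDiffOn_tangentLift hU hχ).of_le (by exact_mod_cast le_top))

theorem continuousOn_jet {h : ℝ} (hh : 0 < h) {ξ : ℝ → V} (hξ : ContDiffOn ℝ 2 ξ (Icc 0 h)) :
    ContinuousOn (jet h ξ) (Icc 0 h) :=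
  hξ.continuousOn.prodMk (hξ.continuousOn_derivWithin (uniqueDiffOn_Icc hh) (by norm_num))

section Action

variable [IsManifold 𝓘(ℝ, E) ∞ G] {χ : V → G} {U : Set V} (hU : IsOpen U)
  (hχ : ContMDiffOn 𝓘(ℝ, V) 𝓘(ℝ, E) ∞ χ U) {W : Set (V × V)} (hWU : W ⊆ U ×ˢ univ)
  {L : TangentBundle 𝓘(ℝ, E) G → ℝ}

include hU hχ hWU

omit [IsManifold 𝓘(ℝ, E) ∞ G] in
theorem action_eq_integral_coordLagrangian {h : ℝ} (hh : 0 < h) {ξ : ℝ → V}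
    (hξ : Admissible W h ξ) :
    action L h (fun t => χ (ξ t)) = ∫ t in (0 : ℝ)..h, coordLagrangian L χ (jet h ξ t) := by
  refine intervalIntegral.integral_congr fun t ht => ?_
  rw [uIcc_of_le hh.le] at ht
  refine congrArg L (velocity_comp χ hh ξ ht ((hξ.1.differentiableOn (by norm_num)) t ht) ?_)
  exact (hχ.contMDiffAt (hU.mem_nhds (hWU (hξ.2 t ht)).1)).mdifferentiableAt (by simp)

theorem continuousOn_coordLagrangian_jet
    (hL : ContMDiff 𝓘(ℝ, E).tangent 𝓘(ℝ, ℝ) 2 L) {h : ℝ} (hh : 0 < h) {ξ : ℝ → V}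
    (hξ : Admissible W h ξ) :
    ContinuousOn (fun t => coordLagrangian L χ (jet h ξ t)) (Icc 0 h) :=
  (contDiffOn_coordLagrangian hU hχ (k := 2) hL).continuousOn.comp (continuousOn_jet hh hξ.1)
    fun t ht => hWU (hξ.2 t ht)

/-- The action depends continuously on the curve. -/
theorem abs_action_sub_action_le (hL : ContMDiff 𝓘(ℝ, E).tangent 𝓘(ℝ, ℝ) 2 L)
    {eG : G → G → ℝ} {eT : TangentBundle 𝓘(ℝ, E) G → TangentBundle 𝓘(ℝ, E) G → ℝ}
    {CL : ℝ} (hCL : 0 ≤ CL)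
    (hLip : ∀ z ∈ W, ∀ z' ∈ W, |L (tangentLift χ z) - L (tangentLift χ z')| ≤
        CL * (eG (χ z.1) (χ z'.1) + eT (tangentLift χ z) (tangentLift χ z')))
    {CG CT CGT : ℝ} (hCG : 0 ≤ CG) (hCT : 0 ≤ CT) (hCGT : 0 ≤ CGT)
    (hcondG : ∀ z ∈ W, ∀ z' ∈ W, eG (χ z.1) (χ z'.1) ≤ CG * ‖z.1 - z'.1‖)
    (hcondT : ∀ z ∈ W, ∀ z' ∈ W, eT (tangentLift χ z) (tangentLift χ z') ≤
        CT * ‖z.2 - z'.2‖ + CGT * ‖z.1 - z'.1‖)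
    {h : ℝ} (hh : 0 < h) {ξ ξ' : ℝ → V} (hξ : Admissible W h ξ) (hξ' : Admissible W h ξ')
    {ε ε' : ℝ} (hε : ∀ t ∈ Icc 0 h, ‖ξ t - ξ' t‖ ≤ ε)
    (hε' : ∀ t ∈ Icc 0 h, ‖derivWithin ξ (Icc 0 h) t - derivWithin ξ' (Icc 0 h) t‖ ≤ ε') :
    |action L h (fun t => χ (ξ t)) - action L h (fun t => χ (ξ' t))| ≤
      CL * ((CG + CGT) * ε + CT * ε') * h := by
  have hi : ∀ ξ : ℝ → V, Admissible W h ξ →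
      IntervalIntegrable (fun t => coordLagrangian L χ (jet h ξ t)) volume 0 h := fun ξ hξ =>
    ((continuousOn_coordLagrangian_jet hU hχ hWU hL hh hξ).mono
      (by rw [uIcc_of_le hh.le])).intervalIntegrable
  rw [action_eq_integral_coordLagrangian hU hχ hWU hh hξ,
    action_eq_integral_coordLagrangian hU hχ hWU hh hξ',
    ← intervalIntegral.integral_sub (hi ξ hξ) (hi ξ' hξ')]
  have hb := intervalIntegral.norm_integral_le_of_norm_le_const (a := 0) (b := h)
    (C := CL * ((CG + CGT) * ε + CT * ε'))
    (f := fun t => coordLagrangian L χ (jet h ξ t) - coordLagrangian L χ (jet h ξ' t)) ?_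
  · simpa [abs_of_pos hh] using hb
  intro t ht
  rw [uIoc_of_le hh.le] at ht
  have ht' : t ∈ Icc 0 h := Ioc_subset_Icc_self ht
  have hz := hξ.2 t ht'
  have hz' := hξ'.2 t ht'
  refine (hLip _ hz _ hz').trans (mul_le_mul_of_nonneg_left ?_ hCL)
  have h1 := hcondG _ hz _ hz'
  have h2 := hcondT _ hz _ hz'
  have h3 : ‖(jet h ξ t).1 - (jet h ξ' t).1‖ ≤ ε := hε t ht'
  have h4 : ‖(jet h ξ t).2 - (jet h ξ' t).2‖ ≤ ε' := hε' t ht'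
  have h5 := mul_le_mul_of_nonneg_left h3 hCG
  have h6 := mul_le_mul_of_nonneg_left h3 hCGT
  have h7 := mul_le_mul_of_nonneg_left h4 hCT
  linarith

end Action

end Chart

/-! ### The Euler-Lagrange equations as a first-order system. -/

section EulerLagrange

variable {V : Type*} [NormedAddCommGroup V] [InnerProductSpace ℝ V]

/-- `η` is a solution on `[0,h]` of the Euler-Lagrange equations of `ℓ : V × V → ℝ`. -/
def IsEulerLagrange (ℓ : V × V → ℝ) (W : Set (V × V)) (h : ℝ) (η : ℝ → V) : Prop :=
  Admissible W h η ∧ ∀ t ∈ Icc 0 h,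
    HasDerivWithinAt (fun s => momentum ℓ (jet h η s)) (force ℓ (jet h η t)) (Icc 0 h) t

section Regularity

variable {ℓ : V × V → ℝ} {O : Set (V × V)}

theorem momentum_eq {z : V × V} (hℓ : DifferentiableAt ℝ ℓ z) :
    momentum ℓ z = (fderiv ℝ ℓ z).comp (ContinuousLinearMap.inr ℝ V V) :=
  (HasFDerivAt.comp (g := ℓ) z.2 (hℓ.hasFDerivAt : HasFDerivAt ℓ (fderiv ℝ ℓ z) (z.1, z.2))
    (hasFDerivAt_prodMk_right z.1 z.2)).fderiv

theorem force_eq {z : V × V} (hℓ : DifferentiableAt ℝ ℓ z) :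
    force ℓ z = (fderiv ℝ ℓ z).comp (ContinuousLinearMap.inl ℝ V V) :=
  (HasFDerivAt.comp (g := ℓ) z.1 (hℓ.hasFDerivAt : HasFDerivAt ℓ (fderiv ℝ ℓ z) (z.1, z.2))
    (hasFDerivAt_prodMk_left z.1 z.2)).fderiv

theorem contDiffOn_momentum (hO : IsOpen O) (hℓ : ContDiffOn ℝ ∞ ℓ O) :
    ContDiffOn ℝ ∞ (momentum ℓ) O :=
  ((hℓ.fderiv_of_isOpen hO (by simp)).clm_comp contDiffOn_const).congr fun _ hz =>
    momentum_eq ((hℓ.differentiableOn (by simp)).differentiableAt (hO.mem_nhds hz))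

theorem contDiffOn_force (hO : IsOpen O) (hℓ : ContDiffOn ℝ ∞ ℓ O) :
    ContDiffOn ℝ ∞ (force ℓ) O :=
  ((hℓ.fderiv_of_isOpen hO (by simp)).clm_comp contDiffOn_const).congr fun _ hz =>
    force_eq ((hℓ.differentiableOn (by simp)).differentiableAt (hO.mem_nhds hz))

/-- The mass matrix `∂²ℓ/∂v²`. -/
noncomputable def massMatrix (ℓ : V × V → ℝ) (z : V × V) : V →L[ℝ] V →L[ℝ] ℝ :=
  (fderiv ℝ (momentum ℓ) z).comp (ContinuousLinearMap.inr ℝ V V)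

theorem fderiv_momentum_snd_eq (hO : IsOpen O) (hℓ : ContDiffOn ℝ ∞ ℓ O) {z : V × V}
    (hz : z ∈ O) : fderiv ℝ (fun v => momentum ℓ (z.1, v)) z.2 = massMatrix ℓ z := by
  have h1 : HasFDerivAt (momentum ℓ) (fderiv ℝ (momentum ℓ) z) (z.1, z.2) :=
    (((contDiffOn_momentum hO hℓ).differentiableOn (by simp)).differentiableAt
      (hO.mem_nhds hz)).hasFDerivAt
  exact (h1.comp z.2 (hasFDerivAt_prodMk_right z.1 z.2)).fderiv

/-- The acceleration determined by the Euler-Lagrange equations. -/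
noncomputable def acceleration (ℓ : V × V → ℝ) (z : V × V) : V :=
  (massMatrix ℓ z).inverse (force ℓ z - fderiv ℝ (momentum ℓ) z (z.2, 0))

theorem fderiv_momentum_apply (ℓ : V × V → ℝ) (z : V × V) (v a : V) :
    fderiv ℝ (momentum ℓ) z (v, a) = fderiv ℝ (momentum ℓ) z (v, 0) + massMatrix ℓ z a := by
  rw [massMatrix, ContinuousLinearMap.comp_apply, ← map_add]
  simp

variable [FiniteDimensional ℝ V] {Z : Set (V × V)}

theorem isInvertible_massMatrix (hO : IsOpen O) (hℓ : ContDiffOn ℝ ∞ ℓ O) (hZO : Z ⊆ O)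
    (hreg : RegularOn ℓ Z) {z : V × V} (hz : z ∈ Z) : (massMatrix ℓ z).IsInvertible :=
  isInvertible_of_injective_dual (fderiv_momentum_snd_eq hO hℓ (hZO hz) ▸ hreg z hz)

theorem contDiffOn_acceleration (hO : IsOpen O) (hℓ : ContDiffOn ℝ ∞ ℓ O) (hZO : Z ⊆ O)
    (hreg : RegularOn ℓ Z) : ContDiffOn ℝ ∞ (acceleration ℓ) Z := by
  have h1 : ContDiffOn ℝ ∞ (fderiv ℝ (momentum ℓ)) Z :=
    ((contDiffOn_momentum hO hℓ).fderiv_of_isOpen hO (by simp)).mono hZO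
  have h2 : ContDiffOn ℝ ∞ (massMatrix ℓ) Z := h1.clm_comp contDiffOn_const
  have h3 : ContDiffOn ℝ ∞ (fun z => (massMatrix ℓ z).inverse) Z := fun z hz =>
    (isInvertible_massMatrix hO hℓ hZO hreg hz).contDiffAt_map_inverse.comp_contDiffWithinAt z
      (h2 z hz)
  refine h3.clm_apply (((contDiffOn_force hO hℓ).mono hZO).sub (h1.clm_apply ?_))
  exact (contDiff_snd.prodMk contDiff_const).contDiffOn

end Regularity

section Jets

theorem hasDerivWithinAt_jet {h : ℝ} (hh : 0 < h) {γ : ℝ → V} (hγ : ContDiffOn ℝ 2 γ (Icc 0 h))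
    {t : ℝ} (ht : t ∈ Icc 0 h) :
    HasDerivWithinAt (jet h γ)
      (derivWithin γ (Icc 0 h) t, derivWithin (derivWithin γ (Icc 0 h)) (Icc 0 h) t)
      (Icc 0 h) t := by
  have hu := uniqueDiffOn_Icc hh
  have h1 : ContDiffOn ℝ 1 (derivWithin γ (Icc 0 h)) (Icc 0 h) :=
    hγ.derivWithin hu (by norm_num)
  exact (((hγ.differentiableOn (by norm_num)) t ht).hasDerivWithinAt).prodMk
    (((h1.differentiableOn (by norm_num)) t ht).hasDerivWithinAt)

theorem jet_eq_of_hasDerivWithinAt {h : ℝ} (hh : 0 < h) {γ : ℝ → V} {t : ℝ} (ht : t ∈ Icc 0 h)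
    {v : V} (hγ : HasDerivWithinAt γ v (Icc 0 h) t) : jet h γ t = (γ t, v) := by
  rw [jet, hγ.derivWithin (uniqueDiffOn_Icc hh t ht)]

theorem jet_comp_add {h h' s : ℝ} (hh' : 0 < h') (hs : 0 ≤ s) (hsh : h' + s ≤ h) {γ : ℝ → V}
    (hγ : ContDiffOn ℝ 2 γ (Icc 0 h)) {t : ℝ} (ht : t ∈ Icc 0 h') :
    jet h' (fun t => γ (t + s)) t = jet h γ (t + s) := by
  have hm : t + s ∈ Icc 0 h := ⟨by linarith [ht.1], by linarith [ht.2]⟩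
  have h1 := ((hγ.differentiableOn (by norm_num)) _ hm).hasDerivWithinAt
  have h2 : HasDerivWithinAt (fun t => t + s) 1 (Icc 0 h') t :=
    (hasDerivWithinAt_id t _).add_const s
  have hmaps : MapsTo (fun t => t + s) (Icc 0 h') (Icc 0 h) :=
    fun u hu => ⟨by linarith [hu.1], by linarith [hu.2]⟩
  have h3 := h1.scomp t h2 hmaps
  rw [one_smul] at h3
  exact jet_eq_of_hasDerivWithinAt hh' ht h3

/-- A solution may be restricted to a subinterval. -/
theorem IsEulerLagrange.comp_add {ℓ : V × V → ℝ} {W : Set (V × V)} {h h' s : ℝ} (hh' : 0 < h')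
    (hs : 0 ≤ s) (hsh : h' + s ≤ h) {γ : ℝ → V} (hγ : IsEulerLagrange ℓ W h γ) :
    IsEulerLagrange ℓ W h' (fun t => γ (t + s)) := by
  have hmaps : MapsTo (fun t => t + s) (Icc 0 h') (Icc 0 h) :=
    fun u hu => ⟨by linarith [hu.1], by linarith [hu.2]⟩
  have hjet : ∀ t ∈ Icc 0 h', jet h' (fun t => γ (t + s)) t = jet h γ (t + s) := fun t ht =>
    jet_comp_add hh' hs hsh hγ.1.1 ht
  refine ⟨⟨hγ.1.1.comp (contDiff_id.add contDiff_const).contDiffOn hmaps, fun t ht => ?_⟩,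
    fun t ht => ?_⟩
  · rw [hjet t ht]; exact hγ.1.2 _ (hmaps ht)
  · rw [hjet t ht]
    have h2 : HasDerivWithinAt (fun t => t + s) 1 (Icc 0 h') t :=
      (hasDerivWithinAt_id t _).add_const s
    have h3 := (hγ.2 _ (hmaps ht)).scomp t h2 hmaps
    rw [one_smul] at h3
    exact h3.congr (fun u hu => congrArg (momentum ℓ) (hjet u hu))
      (congrArg (momentum ℓ) (hjet t ht))

end Jets

section Flow

variable [FiniteDimensional ℝ V] {ℓ : V × V → ℝ} {O W Z : Set (V × V)}

/-- Expanding `d/dt ∂ℓ/∂v` by the chain rule leaves the mass matrix applied to the second derivative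
of `γ`; inverting it solves for that derivative. -/
theorem IsEulerLagrange.hasDerivWithinAt_jet (hO : IsOpen O) (hℓ : ContDiffOn ℝ ∞ ℓ O)
    (hZO : Z ⊆ O) (hreg : RegularOn ℓ Z) {h : ℝ} (hh : 0 < h) {γ : ℝ → V}
    (hγ : IsEulerLagrange ℓ W h γ) {t : ℝ} (ht : t ∈ Icc 0 h) (htZ : jet h γ t ∈ Z) :
    HasDerivWithinAt (jet h γ) ((jet h γ t).2, acceleration ℓ (jet h γ t)) (Icc 0 h) t := by
  have h1 := LieGalerkin.hasDerivWithinAt_jet hh hγ.1.1 ht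
  set a := derivWithin (derivWithin γ (Icc 0 h)) (Icc 0 h) t
  have h2 : HasFDerivAt (momentum ℓ) (fderiv ℝ (momentum ℓ) (jet h γ t)) (jet h γ t) :=
    (((contDiffOn_momentum hO hℓ).differentiableOn (by simp)).differentiableAt
      (hO.mem_nhds (hZO htZ))).hasFDerivAt
  have h3 : fderiv ℝ (momentum ℓ) (jet h γ t) ((jet h γ t).2, a) = force ℓ (jet h γ t) :=
    (uniqueDiffOn_Icc hh t ht).eq_deriv _ (h2.comp_hasDerivWithinAt t h1) (hγ.2 t ht)
  rw [fderiv_momentum_apply] at h3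
  have h4 : acceleration ℓ (jet h γ t) = a := by
    obtain ⟨A, hA⟩ := isInvertible_massMatrix hO hℓ hZO hreg htZ
    rw [acceleration, ← h3, add_sub_cancel_left, ← hA]
    simp
  rw [h4]
  exact h1

/-- Solutions that start in a compact set stay close to the initial state, uniformly. -/
theorem exists_norm_jet_sub_le (hO : IsOpen O) (hℓ : ContDiffOn ℝ ∞ ℓ O) (hZ : IsOpen Z)
    (hZO : Z ⊆ O) (hreg : RegularOn ℓ Z) {K : Set (V × V)} (hK : IsCompact K) (hKZ : K ⊆ Z) :
    ∃ M h₁, 0 < M ∧ 0 < h₁ ∧ ∀ h ∈ Ioo 0 h₁, ∀ γ : ℝ → V, IsEulerLagrange ℓ W h γ →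
      jet h γ 0 ∈ K → ∀ t ∈ Icc 0 h, ‖jet h γ t - jet h γ 0‖ ≤ M * t := by
  obtain ⟨ρ, hρ, hρZ⟩ := hK.exists_cthickening_subset_open hZ hKZ
  have hc : ContinuousOn (fun z : V × V => (z.2, acceleration ℓ z)) (cthickening ρ K) :=
    continuousOn_snd.prodMk ((contDiffOn_acceleration hO hℓ hZO hreg).continuousOn.mono hρZ)
  obtain ⟨M₀, hM₀⟩ := hK.cthickening.exists_bound_of_continuousOn hc
  set M := max M₀ 0 + 1 with hM
  have hMpos : 0 < M := by positivity
  refine ⟨M, ρ / M, hMpos, by positivity, fun h hh γ hγ h0 => ?_⟩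
  have hMh : M * h ≤ ρ := by
    have := hh.2.le
    rwa [le_div_iff₀ hMpos, mul_comm] at this
  -- A barrier argument: the speed need only be bounded where the distance from the start equals `M
  -- * t`. There `M * h ≤ ρ` keeps the state in the compact thickening of `K`, where the speed is
  -- below `M`; the `+ 1` in `M` makes this strict.
  have key : ∀ t ∈ Ico 0 h, ‖jet h γ t - jet h γ 0‖ = M * t → jet h γ t ∈ cthickening ρ K := by
    intro t ht he
    refine mem_cthickening_of_dist_le _ _ _ _ h0 ?_
    rw [dist_eq_norm, he]
    exact (mul_le_mul_of_nonneg_left ht.2.le hMpos.le).trans hMh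
  refine image_norm_le_of_norm_deriv_right_lt_deriv_boundary
    (f := fun t => jet h γ t - jet h γ 0) (B := fun t => M * t) (B' := fun _ => M)
    (f' := fun t => (derivWithin γ (Icc 0 h) t,
      derivWithin (derivWithin γ (Icc 0 h)) (Icc 0 h) t)) ?_ ?_ ?_ ?_ ?_
  · exact (continuousOn_jet hh.1 hγ.1.1).sub continuousOn_const
  · intro t ht
    have h1 := LieGalerkin.hasDerivWithinAt_jet hh.1 hγ.1.1 (Ico_subset_Icc_self ht)
    exact (h1.mono_of_mem_nhdsWithin (Icc_mem_nhdsGE_of_mem ht)).sub_const _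
  · simp
  · intro t
    simpa using (hasDerivAt_id t).const_mul M
  · intro t ht he
    have hm := key t ht he
    have h1 := LieGalerkin.hasDerivWithinAt_jet hh.1 hγ.1.1 (Ico_subset_Icc_self ht)
    have h2 := hγ.hasDerivWithinAt_jet hO hℓ hZO hreg hh.1 (Ico_subset_Icc_self ht) (hρZ hm)
    rw [(uniqueDiffOn_Icc hh.1 t (Ico_subset_Icc_self ht)).eq_deriv _ h1 h2]
    exact ((hM₀ _ hm).trans (le_max_left _ _)).trans_lt (lt_add_one _)

/-- Local solvability of the Euler-Lagrange equations. -/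
theorem exists_isEulerLagrange (hO : IsOpen O) (hℓ : ContDiffOn ℝ ∞ ℓ O) (hZ : IsOpen Z)
    (hZO : Z ⊆ O) (hreg : RegularOn ℓ Z) (hZW : Z ⊆ W) {z : V × V} (hz : z ∈ Z) :
    ∃ δ > 0, ∃ γ : ℝ → V, IsEulerLagrange ℓ W δ γ ∧ jet δ γ 0 = z := by
  have hacc := contDiffOn_acceleration hO hℓ hZO hreg
  have hF : ContDiffAt ℝ 1 (fun z : V × V => (z.2, acceleration ℓ z)) z :=
    contDiffAt_snd.prodMk ((hacc.contDiffAt (hZ.mem_nhds hz)).of_le (by simp))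
  obtain ⟨r, hr, ε, hε, hα⟩ :=
    hF.exists_forall_mem_closedBall_exists_eq_forall_mem_Ioo_hasDerivAt 0
  obtain ⟨α, hα0, hα⟩ := hα z (mem_closedBall_self hr.le)
  simp only [zero_sub, zero_add] at hα
  have hαc : ContinuousAt α 0 := (hα 0 ⟨by linarith, hε⟩).continuousAt
  obtain ⟨ε', hε', hZα⟩ := Metric.eventually_nhds_iff.1
    (hαc.eventually (by rw [hα0]; exact hZ.mem_nhds hz))
  set δ := min ε ε' / 2 with hδ
  have hδ0 : 0 < δ := by positivity
  set I : Set ℝ := Ioo (-(min ε ε')) (min ε ε') with hI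
  have hIo : IsOpen I := isOpen_Ioo
  have hIα : ∀ t ∈ I, HasDerivAt α ((α t).2, acceleration ℓ (α t)) t := fun t ht =>
    hα t ⟨by linarith [ht.1, min_le_left ε ε'], ht.2.trans_le (min_le_left _ _)⟩
  have hIZ : ∀ t ∈ I, α t ∈ Z := fun t ht => hZα (by
    rw [Real.dist_eq, sub_zero, abs_lt]
    exact ⟨by linarith [ht.1, min_le_right ε ε'], ht.2.trans_le (min_le_right _ _)⟩)
  have hsub : Icc 0 δ ⊆ I := fun t ht =>
    ⟨by linarith [ht.1, lt_min hε hε'], by linarith [ht.2, lt_min hε hε']⟩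
  have hαcont : ContinuousOn α I := fun t ht => (hIα t ht).continuousAt.continuousWithinAt
  have hd1 : ∀ t ∈ I, HasDerivAt (fun t => (α t).1) (α t).2 t := fun t ht =>
    (hasFDerivAt_fst (𝕜 := ℝ) (p := α t)).comp_hasDerivAt t (hIα t ht)
  have hd2 : ∀ t ∈ I, HasDerivAt (fun t => (α t).2) (acceleration ℓ (α t)) t := fun t ht =>
    (hasFDerivAt_snd (𝕜 := ℝ) (p := α t)).comp_hasDerivAt t (hIα t ht)
  -- The integral curve is only known to be differentiable; the equation itself raises the velocity
  -- to `C¹` and the position to `C²`.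
  have hs2 : ContDiffOn ℝ 1 (fun t => (α t).2) I := by
    rw [show (1 : WithTop ℕ∞) = 0 + 1 by simp, contDiffOn_succ_iff_deriv_of_isOpen hIo]
    refine ⟨fun t ht => (hd2 t ht).differentiableAt.differentiableWithinAt, by simp, ?_⟩
    rw [contDiffOn_zero]
    exact (hacc.continuousOn.comp hαcont hIZ).congr fun t ht => (hd2 t ht).deriv
  have hs1 : ContDiffOn ℝ 2 (fun t => (α t).1) I := by
    rw [show (2 : WithTop ℕ∞) = 1 + 1 by norm_num, contDiffOn_succ_iff_deriv_of_isOpen hIo]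
    exact ⟨fun t ht => (hd1 t ht).differentiableAt.differentiableWithinAt, by simp,
      hs2.congr fun t ht => (hd1 t ht).deriv⟩
  have hjet : ∀ t ∈ Icc 0 δ, jet δ (fun t => (α t).1) t = α t := fun t ht =>
    jet_eq_of_hasDerivWithinAt hδ0 ht (hd1 t (hsub ht)).hasDerivWithinAt
  refine ⟨δ, hδ0, fun t => (α t).1, ⟨⟨hs1.mono hsub, fun t ht => ?_⟩, fun t ht => ?_⟩, ?_⟩
  · rw [hjet t ht]
    exact hZW (hIZ t (hsub ht))
  · rw [hjet t ht]
    have htZ := hIZ t (hsub ht)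
    have h2 : HasFDerivAt (momentum ℓ) (fderiv ℝ (momentum ℓ) (α t)) (α t) :=
      (((contDiffOn_momentum hO hℓ).differentiableOn (by simp)).differentiableAt
        (hO.mem_nhds (hZO htZ))).hasFDerivAt
    have h3 := (h2.comp_hasDerivAt t (hIα t (hsub ht))).hasDerivWithinAt (s := Icc 0 δ)
    have h4 : fderiv ℝ (momentum ℓ) (α t) ((α t).2, acceleration ℓ (α t)) = force ℓ (α t) := by
      rw [fderiv_momentum_apply]
      obtain ⟨A, hA⟩ := isInvertible_massMatrix hO hℓ hZO hreg htZ
      rw [acceleration, ← hA]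
      simp
    rw [h4] at h3
    exact h3.congr (fun u hu => congrArg (momentum ℓ) (hjet u hu))
      (congrArg (momentum ℓ) (hjet t ht))
  · rw [hjet 0 ⟨le_rfl, hδ0.le⟩, hα0]

end Flow

end EulerLagrange

/-! ### The first variation of the action under affine variations. -/

section FirstVariation

variable {V : Type*} [NormedAddCommGroup V] [InnerProductSpace ℝ V]
  {ℓ : V × V → ℝ} {O W : Set (V × V)} {h : ℝ} {γ : ℝ → V}

/-- Affine variations suffice: `α = 1`, `β = -h⁻¹` moves only the initial point, and `α = 0`, `β =
h⁻¹` only the final one, in each case by exactly `w`. -/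
theorem jet_add_smul (hh : 0 < h) (hγ : ContDiffOn ℝ 2 γ (Icc 0 h)) (α β : ℝ) (w : V) {t : ℝ}
    (ht : t ∈ Icc 0 h) :
    jet h (fun t => γ t + (α + β * t) • w) t = jet h γ t + ((α + β * t) • w, β • w) := by
  have h1 := ((hγ.differentiableOn (by norm_num)) t ht).hasDerivWithinAt
  have h2 : HasDerivWithinAt (fun t : ℝ => (α + β * t) • w) (β • w) (Icc 0 h) t := by
    have : HasDerivAt (fun t : ℝ => α + β * t) β t := by
      simpa using ((hasDerivAt_id t).const_mul β).const_add α
    exact (this.smul_const w).hasDerivWithinAt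
  exact jet_eq_of_hasDerivWithinAt hh ht (h1.add h2)

/-- Compactness of `[0, h]` yields one neighbourhood of `w = 0` that serves all times. -/
theorem eventually_jet_add_mem (hO : IsOpen O) (hh : 0 < h) (hγ : Admissible W h γ) (hWO : W ⊆ O)
    (α β : ℝ) : ∀ᶠ w in 𝓝 (0 : V), ∀ t ∈ Icc 0 h,
      jet h γ t + ((α + β * t) • w, β • w) ∈ O := by
  have h1 := isCompact_Icc.eventually_forall_of_forall_eventually (K := Icc 0 h) (x₀ := (0 : V))
    (P := fun w t => t ∈ Icc 0 h → jet h γ t + ((α + β * t) • w, β • w) ∈ O) ?_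
  · filter_upwards [h1] with w hw t ht using hw t ht ht
  intro t ht
  have hc : ContinuousOn (fun p : V × ℝ => jet h γ p.2 + ((α + β * p.2) • p.1, β • p.1))
      (univ ×ˢ Icc 0 h) :=
    ((continuousOn_jet hh hγ.1).comp continuousOn_snd fun p hp => hp.2).add
      (by fun_prop : Continuous fun p : V × ℝ => ((α + β * p.2) • p.1, β • p.1)).continuousOn
  have h2 := (hc ((0 : V), t) ⟨mem_univ _, ht⟩).eventually
    (hO.mem_nhds (by simpa [Prod.mk_zero_zero] using hWO (hγ.2 t ht)))
  rw [eventually_nhdsWithin_iff] at h2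
  filter_upwards [h2] with p hp hpt using hp ⟨mem_univ _, hpt⟩

theorem eventually_admissible_add (hW : IsOpen W) (hh : 0 < h) (hγ : Admissible W h γ)
    (α β : ℝ) : ∀ᶠ w in 𝓝 (0 : V), Admissible W h (fun t => γ t + (α + β * t) • w) := by
  filter_upwards [eventually_jet_add_mem hW hh hγ subset_rfl α β] with w hw
  refine ⟨hγ.1.add (by fun_prop : ContDiff ℝ 2 fun t : ℝ => (α + β * t) • w).contDiffOn,
    fun t ht => ?_⟩
  rw [jet_add_smul hh hγ.1 α β w ht]
  exact hw t ht

/-- The first variation of the action along a solution of the Euler-Lagrange equations consists of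
boundary terms only. -/
theorem hasFDerivAt_action_add (hO : IsOpen O) (hℓ : ContDiffOn ℝ ∞ ℓ O) (hWO : W ⊆ O)
    (hh : 0 < h) (hγ : IsEulerLagrange ℓ W h γ) (α β : ℝ) :
    HasFDerivAt (fun w : V => ∫ t in (0 : ℝ)..h, ℓ (jet h γ t + ((α + β * t) • w, β • w)))
      ((α + β * h) • momentum ℓ (jet h γ h) - α • momentum ℓ (jet h γ 0)) 0 := by
  obtain ⟨S, hSP, hS, h0S⟩ := _root_.mem_nhds_iff.1 (eventually_jet_add_mem hO hh hγ.1 hWO α β)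
  have hdiff : ∀ z ∈ O, HasFDerivAt ℓ (fderiv ℝ ℓ z) z := fun z hz =>
    ((hℓ.differentiableOn (by simp)).differentiableAt (hO.mem_nhds hz)).hasFDerivAt
  set D : ℝ → V →L[ℝ] V × V := fun t =>
    (α + β * t) • ContinuousLinearMap.inl ℝ V V + β • ContinuousLinearMap.inr ℝ V V with hD
  have hDap : ∀ t w, D t w = ((α + β * t) • w, β • w) := fun t w => by simp [hD]
  have hjc := continuousOn_jet hh hγ.1.1
  have hDc : Continuous D := by fun_prop
  have hcj : ContinuousOn (fun p : V × ℝ => jet h γ p.2 + D p.2 p.1) (S ×ˢ Icc 0 h) :=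
    (hjc.comp continuousOn_snd fun p hp => hp.2).add
      ((hDc.comp continuous_snd).clm_apply continuous_fst).continuousOn
  have hmaps : ∀ p ∈ S ×ˢ Icc 0 h, jet h γ p.2 + D p.2 p.1 ∈ O := fun p hp => by
    rw [hDap]; exact hSP hp.1 p.2 hp.2
  have h1 := hasFDerivAt_integral_of_continuousOn (f := fun w t => ℓ (jet h γ t + D t w))
    (f' := fun w t => (fderiv ℝ ℓ (jet h γ t + D t w)).comp (D t)) hS hh.le ?_ ?_ ?_ h0S
  · have h2 : (∫ t in (0 : ℝ)..h, (fderiv ℝ ℓ (jet h γ t + D t 0)).comp (D t)) =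
        (α + β * h) • momentum ℓ (jet h γ h) - α • momentum ℓ (jet h γ 0) := by
      -- By the Euler-Lagrange equations the varied integrand is a total derivative, that of `(α + β
      -- t)` times the momentum.
      have hder : ∀ t ∈ Icc 0 h, HasDerivWithinAt
          (fun t => (α + β * t) • momentum ℓ (jet h γ t))
          ((fderiv ℝ ℓ (jet h γ t + D t 0)).comp (D t)) (Icc 0 h) t := by
        intro t ht
        have ha : HasDerivWithinAt (fun t : ℝ => α + β * t) β (Icc 0 h) t := by
          simpa using (((hasDerivAt_id t).const_mul β).const_add α).hasDerivWithinAt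
        have hda := (hdiff _ (hWO (hγ.1.2 t ht))).differentiableAt
        have h3 := ha.smul (hγ.2 t ht)
        rw [momentum_eq hda, force_eq hda] at h3
        have h4 : (fderiv ℝ ℓ (jet h γ t + D t 0)).comp (D t) =
            (α + β * t) • (fderiv ℝ ℓ (jet h γ t)).comp (ContinuousLinearMap.inl ℝ V V) +
              β • (fderiv ℝ ℓ (jet h γ t)).comp (ContinuousLinearMap.inr ℝ V V) := by
          rw [map_zero, add_zero, hD, ContinuousLinearMap.comp_add,
            ContinuousLinearMap.comp_smul, ContinuousLinearMap.comp_smul]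
        rw [h4]
        exact h3
      rw [intervalIntegral.integral_eq_sub_of_hasDerivAt_of_le hh.le
        (fun t ht => (hder t ht).continuousWithinAt)
        (fun t ht => (hder t (Ioo_subset_Icc_self ht)).hasDerivAt (Icc_mem_nhds ht.1 ht.2)) ?_]
      · simp
      · refine ContinuousOn.intervalIntegrable ?_
        rw [uIcc_of_le hh.le]
        refine ContinuousOn.clm_comp ?_ hDc.continuousOn
        refine (hℓ.continuousOn_fderiv_of_isOpen hO (by simp)).comp
          (hcj.comp (by fun_prop : ContinuousOn (fun t : ℝ => ((0 : V), t)) (Icc 0 h))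
            fun t ht => ⟨h0S, ht⟩) fun t ht => hmaps (0, t) ⟨h0S, ht⟩
    rw [h2] at h1
    simpa only [hDap] using h1
  · intro w hw
    exact hℓ.continuousOn.comp (hcj.comp
      (by fun_prop : ContinuousOn (fun t : ℝ => (w, t)) (Icc 0 h)) fun t ht => ⟨hw, ht⟩)
      fun t ht => hmaps (w, t) ⟨hw, ht⟩
  · exact ((hℓ.continuousOn_fderiv_of_isOpen hO (by simp)).comp hcj hmaps).clm_comp
      (hDc.comp continuous_snd).continuousOn
  · intro w hw t ht
    exact HasFDerivAt.comp (g := ℓ) w (hdiff _ (hmaps (w, t) ⟨hw, ht⟩))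
      ((D t).hasFDerivAt.const_add (jet h γ t))

/-- A differentiable function that lies below the action of the variations of a solution, with
equality at the solution, has the boundary terms of the first variation as its derivative. -/
theorem fderiv_eq_of_le_action (hO : IsOpen O) (hℓ : ContDiffOn ℝ ∞ ℓ O) (hWO : W ⊆ O)
    (hh : 0 < h) (hγ : IsEulerLagrange ℓ W h γ) (α β : ℝ) {f : V → ℝ} {f' : V →L[ℝ] ℝ}
    (hf : HasFDerivAt f f' 0)
    (hle : ∀ᶠ w in 𝓝 (0 : V),
      f w ≤ ∫ t in (0 : ℝ)..h, ℓ (jet h (fun t => γ t + (α + β * t) • w) t))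
    (heq : f 0 = ∫ t in (0 : ℝ)..h, ℓ (jet h γ t)) :
    f' = (α + β * h) • momentum ℓ (jet h γ h) - α • momentum ℓ (jet h γ 0) := by
  have h1 := (hasFDerivAt_action_add hO hℓ hWO hh hγ α β).sub hf
  -- The action minus `f` is nonnegative near `0` and vanishes at `0`, so its derivative there is
  -- zero. How minimizers depend on the end points never enters.
  have h2 : IsLocalMin (fun w : V =>
      (∫ t in (0 : ℝ)..h, ℓ (jet h γ t + ((α + β * t) • w, β • w))) - f w) 0 := by
    filter_upwards [hle] with w hw
    have h3 : (∫ t in (0 : ℝ)..h, ℓ (jet h (fun t => γ t + (α + β * t) • w) t)) =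
        ∫ t in (0 : ℝ)..h, ℓ (jet h γ t + ((α + β * t) • w, β • w)) := by
      refine intervalIntegral.integral_congr fun t ht => ?_
      rw [uIcc_of_le hh.le] at ht
      exact congrArg ℓ (jet_add_smul hh hγ.1.1 α β w ht)
    have h4 : (∫ t in (0 : ℝ)..h, ℓ (jet h γ t + ((α + β * t) • (0 : V), β • (0 : V)))) =
        ∫ t in (0 : ℝ)..h, ℓ (jet h γ t) := by simp [Prod.mk_zero_zero]
    rw [h3] at hw
    simp only [h4, heq, sub_self]
    linarith
  exact (sub_eq_zero.1 (h2.hasFDerivAt_eq_zero h1)).symm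

end FirstVariation

/-! ### The exact discrete Lagrangian as a generating function of the flow. -/

section ExactLagrangian

variable {E : Type*} [NormedAddCommGroup E] [NormedSpace ℝ E]
  {V : Type*} [NormedAddCommGroup V] [InnerProductSpace ℝ V]
  {G : Type*} [TopologicalSpace G] [ChartedSpace E G]
  {χ : V → G} {U : Set V} (hU : IsOpen U) (hχ : ContMDiffOn 𝓘(ℝ, V) 𝓘(ℝ, E) ∞ χ U)
  {W : Set (V × V)} (hWU : W ⊆ U ×ˢ univ) {L : TangentBundle 𝓘(ℝ, E) G → ℝ}
  {h : ℝ} (hh : 0 < h) {P : Set (G × G)} {η : ℝ → G → G → ℝ → V}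
  (hη : ∀ g ∈ P, IsExactSolution L χ W h (η h g.1 g.2) ∧ Joins χ h (η h g.1 g.2) g.1 g.2)
  (hmin : ∀ g ∈ P, ∀ ξ : ℝ → V, IsExactSolution L χ W h ξ → Joins χ h ξ g.1 g.2 →
      ∀ ξ' : ℝ → V, Admissible W h ξ' → Joins χ h ξ' g.1 g.2 →
      action L h (fun t => χ (ξ t)) ≤ action L h (fun t => χ (ξ' t)))

include hU hχ hWU hh hη hmin

theorem exactLd_le_integral {x y : V} (hg : (χ x, χ y) ∈ P) {ξ : ℝ → V} (hξ : Admissible W h ξ)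
    (hx : ξ 0 = x) (hy : ξ h = y) :
    exactLd L χ η (χ x) (χ y) h ≤ ∫ t in (0 : ℝ)..h, coordLagrangian L χ (jet h ξ t) := by
  rw [← action_eq_integral_coordLagrangian hU hχ hWU hh hξ]
  exact hmin _ hg _ (hη _ hg).1 (hη _ hg).2 ξ hξ ⟨congrArg χ hx, congrArg χ hy⟩

/-- Both `γ` and the chosen solution `η` minimize the action for the same end points, so their
actions agree even if the curves do not. -/
theorem exactLd_eq_integral {γ : ℝ → V} (hγ : IsExactSolution L χ W h γ)
    (hg : (χ (γ 0), χ (γ h)) ∈ P) :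
    exactLd L χ η (χ (γ 0)) (χ (γ h)) h =
      ∫ t in (0 : ℝ)..h, coordLagrangian L χ (jet h γ t) := by
  refine le_antisymm (exactLd_le_integral hU hχ hWU hh hη hmin hg hγ.1 rfl rfl) ?_
  rw [← action_eq_integral_coordLagrangian hU hχ hWU hh hγ.1]
  exact hmin _ hg γ hγ ⟨rfl, rfl⟩ _ (hη _ hg).1.1 (hη _ hg).2

/-- The exact discrete Lagrangian generates the flow of the Euler-Lagrange equations. -/
theorem partial_exactLd_eq (hW : IsOpen W)
    (hℓ : ContDiffOn ℝ ∞ (coordLagrangian L χ) (U ×ˢ univ))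
    {γ : ℝ → V} (hγ : IsExactSolution L χ W h γ)
    (hP₁ : ∀ᶠ x in 𝓝 (γ 0), (χ x, χ (γ h)) ∈ P) (hP₂ : ∀ᶠ y in 𝓝 (γ h), (χ (γ 0), χ y) ∈ P)
    (hd₁ : DifferentiableAt ℝ (fun x => exactLd L χ η (χ x) (χ (γ h)) h) (γ 0))
    (hd₂ : DifferentiableAt ℝ (fun y => exactLd L χ η (χ (γ 0)) (χ y) h) (γ h)) :
    partialOne (exactLd L χ η) χ h (γ 0) (γ h) = -momentum (coordLagrangian L χ) (jet h γ 0) ∧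
    partialTwo (exactLd L χ η) χ h (γ 0) (γ h) = momentum (coordLagrangian L χ) (jet h γ h) := by
  have hO : IsOpen (U ×ˢ (univ : Set V)) := hU.prod isOpen_univ
  have heq := exactLd_eq_integral hU hχ hWU hh hη hmin hγ hP₁.self_of_nhds
  have hadd : ∀ x : V, HasFDerivAt (fun w : V => x + w) (ContinuousLinearMap.id ℝ V) 0 := fun x =>
    (hasFDerivAt_id 0).const_add x
  have htend : ∀ x : V, Tendsto (fun w : V => x + w) (𝓝 0) (𝓝 x) := fun x => by
    simpa using (hadd x).continuousAt.tendsto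
  constructor
  · have hd : HasFDerivAt (fun w => exactLd L χ η (χ (γ 0 + w)) (χ (γ h)) h)
        (partialOne (exactLd L χ η) χ h (γ 0) (γ h)) 0 := by
      have h1 : HasFDerivAt (fun x => exactLd L χ η (χ x) (χ (γ h)) h)
        (partialOne (exactLd L χ η) χ h (γ 0) (γ h)) (γ 0 + 0) := by
        rw [add_zero]; exact hd₁.hasFDerivAt
      exact h1.comp (0 : V) (hadd (γ 0))
    have h1 := fderiv_eq_of_le_action hO hℓ hWU hh hγ 1 (-h⁻¹) hd ?_ (by simpa using heq)
    · rw [h1]; simp [hh.ne']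
    · filter_upwards [(htend (γ 0)).eventually hP₁,
        eventually_admissible_add hW hh hγ.1 1 (-h⁻¹)] with w hw hadm
      exact exactLd_le_integral hU hχ hWU hh hη hmin hw hadm (by simp) (by simp [hh.ne'])
  · have hd : HasFDerivAt (fun w => exactLd L χ η (χ (γ 0)) (χ (γ h + w)) h)
        (partialTwo (exactLd L χ η) χ h (γ 0) (γ h)) 0 := by
      have h1 : HasFDerivAt (fun y => exactLd L χ η (χ (γ 0)) (χ y) h)
        (partialTwo (exactLd L χ η) χ h (γ 0) (γ h)) (γ h + 0) := by
        rw [add_zero]; exact hd₂.hasFDerivAt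
      exact h1.comp (0 : V) (hadd (γ h))
    have h1 := fderiv_eq_of_le_action hO hℓ hWU hh hγ 0 h⁻¹ hd ?_ (by simpa using heq)
    · rw [h1]; simp [hh.ne']
    · filter_upwards [(htend (γ h)).eventually hP₂,
        eventually_admissible_add hW hh hγ.1 0 h⁻¹] with w hw hadm
      exact exactLd_le_integral hU hχ hWU hh hη hmin hw hadm (by simp) (by simp [hh.ne'])

end ExactLagrangian

/-! ### Dividing discrete Lagrangians by powers of the step, with `h = k²`. -/

section Factorization

universe u

variable {V : Type u} [NormedAddCommGroup V] [InnerProductSpace ℝ V] {Z : Set (V × V)}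
  {h₀ : ℝ} {f : (V × V) × ℝ → ℝ}

theorem sq_mem_Ico_of_mem_Ioo {k : ℝ} (hk : k ∈ Ioo (-√h₀) √h₀) : k ^ 2 ∈ Ico 0 h₀ := by
  refine ⟨sq_nonneg k, ?_⟩
  rw [← sq_abs]
  have h1 : |k| < √h₀ := abs_lt.2 hk
  exact (Real.lt_sqrt (abs_nonneg k)).1 h1

/-- Substituting `h = k²` replaces the half-open range of `h` by an open interval around `k = 0`, so
that smoothness up to the boundary becomes smoothness on an open set. -/
theorem contDiffOn_comp_sq (hf : ContDiffOn ℝ ∞ f (Z ×ˢ Ico 0 h₀)) :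
    ContDiffOn ℝ ∞ (fun q : (V × V) × ℝ => f (q.1, q.2 ^ 2)) (Z ×ˢ Ioo (-√h₀) √h₀) :=
  hf.comp (by fun_prop : ContDiff ℝ ∞ fun q : (V × V) × ℝ => (q.1, q.2 ^ 2)).contDiffOn
    fun _ hq => ⟨hq.1, sq_mem_Ico_of_mem_Ioo hq.2⟩

/-- As `f (z, k²)` is even in `k`, its quotient by `k` is odd; by continuity the quotient vanishes
at `k = 0` and can be divided by `k` once more. -/
theorem exists_eq_sq_mul (hZ : IsOpen Z) (hh₀ : 0 < h₀) (hf : ContDiffOn ℝ ∞ f (Z ×ˢ Ico 0 h₀))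
    (h0 : ∀ z ∈ Z, f (z, 0) = 0) :
    ∃ B : (V × V) × ℝ → ℝ, ContDiffOn ℝ ∞ B (Z ×ˢ Ioo (-√h₀) √h₀) ∧
      ∀ z ∈ Z, ∀ k ∈ Ioo (-√h₀) √h₀, f (z, k ^ 2) = k ^ 2 * B (z, k) := by
  have ha : 0 < √h₀ := Real.sqrt_pos.2 hh₀
  obtain ⟨g, hg, hfg⟩ := exists_eq_mul_of_forall_eq_zero hZ (contDiffOn_comp_sq hf)
    (by simpa using h0)
  have hodd : ∀ z ∈ Z, g (z, 0) = 0 := by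
    intro z hz
    have hc : ContinuousOn (fun k => g (z, k)) (Ioo (-√h₀) √h₀) :=
      hg.continuousOn.comp (by fun_prop : ContinuousOn (fun k => (z, k)) (Ioo (-√h₀) √h₀))
        fun k hk => ⟨hz, hk⟩
    have h0I : (0 : ℝ) ∈ Ioo (-√h₀) √h₀ := ⟨by linarith, ha⟩
    have h1 : ContinuousAt (fun k => g (z, k)) 0 := hc.continuousAt (isOpen_Ioo.mem_nhds h0I)
    have h2 : Tendsto (fun k : ℝ => g (z, k)) (𝓝[≠] 0) (𝓝 (g (z, 0))) :=
      h1.tendsto.mono_left nhdsWithin_le_nhds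
    have hneg : Tendsto (fun k : ℝ => -k) (𝓝[≠] 0) (𝓝 0) := by
      simpa using (continuous_neg.tendsto (0 : ℝ)).mono_left nhdsWithin_le_nhds
    have h3 : Tendsto (fun k : ℝ => -g (z, -k)) (𝓝[≠] 0) (𝓝 (-g (z, 0))) :=
      (h1.tendsto.comp hneg).neg
    have h4 : (fun k : ℝ => g (z, k)) =ᶠ[𝓝[≠] 0] fun k => -g (z, -k) := by
      filter_upwards [self_mem_nhdsWithin, nhdsWithin_le_nhds (isOpen_Ioo.mem_nhds h0I)]
        with k hk hkI
      have hkI' : -k ∈ Ioo (-√h₀) √h₀ := ⟨by linarith [hkI.2], by linarith [hkI.1]⟩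
      have h5 := hfg z hz k hkI
      have h6 := hfg z hz (-k) hkI'
      simp only [neg_sq] at h6
      rw [h5] at h6
      have hk0 : k ≠ 0 := hk
      apply mul_left_cancel₀ hk0
      linarith
    have h7 := tendsto_nhds_unique (h2.congr' h4) h3
    linarith
  obtain ⟨B, hB, hgB⟩ := exists_eq_mul_of_forall_eq_zero hZ hg hodd
  exact ⟨B, hB, fun z hz k hk => by rw [hfg z hz k hk, hgB z hz k hk]; ring⟩

/-- In terms of `k` the bound is `C |k| ^ (2N)`, which allows `2N` divisions by `k`. This is what
lets an error estimate be differentiated in position and velocity without loss of order. -/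
theorem exists_eq_sq_pow_mul (hZ : IsOpen Z) (hh₀ : 0 < h₀)
    (hf : ContDiffOn ℝ ∞ f (Z ×ˢ Ico 0 h₀)) {C : ℝ} {N : ℕ}
    (hC : ∀ z ∈ Z, ∀ h ∈ Ioo 0 h₀, |f (z, h)| ≤ C * h ^ N) :
    ∃ R : (V × V) × ℝ → ℝ, ContDiffOn ℝ ∞ R (Z ×ˢ Ioo (-√h₀) √h₀) ∧
      ∀ z ∈ Z, ∀ k ∈ Ioo (-√h₀) √h₀, f (z, k ^ 2) = (k ^ 2) ^ N * R (z, k) := by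
  obtain ⟨R, hR, hfR⟩ := exists_eq_pow_mul_of_abs_le (N := 2 * N) (C := C) hZ
    (Real.sqrt_pos.2 hh₀) (contDiffOn_comp_sq hf) fun z hz k hk hk0 => by
      have h1 := sq_mem_Ico_of_mem_Ioo hk
      rw [pow_mul, sq_abs]
      exact hC z hz _ ⟨by positivity, h1.2⟩
  exact ⟨R, hR, fun z hz k hk => by rw [hfR z hz k hk, pow_mul]⟩

/-- The partial derivatives of a discrete Lagrangian in terms of the initial point and the mean
velocity. -/
theorem hasFDerivAt_of_eq_mul (hZ : IsOpen Z) {Q : V → V → ℝ} {B : (V × V) × ℝ → ℝ} {h k : ℝ}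
    (hh : h ≠ 0) (hQ : ∀ z ∈ Z, Q z.1 (z.1 + h • z.2) = h * B (z, k)) {x y : V}
    (hz : (x, h⁻¹ • (y - x)) ∈ Z) (hB : DifferentiableAt ℝ B ((x, h⁻¹ • (y - x)), k)) :
    HasFDerivAt (fun x' => Q x' y) (h • derivFst B ((x, h⁻¹ • (y - x)), k) -
      derivSnd B ((x, h⁻¹ • (y - x)), k)) x ∧
    HasFDerivAt (fun y' => Q x y') (derivSnd B ((x, h⁻¹ • (y - x)), k)) y := by
  have hQ' : ∀ x y, (x, h⁻¹ • (y - x)) ∈ Z → Q x y = h * B ((x, h⁻¹ • (y - x)), k) := by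
    intro x y hxy
    have := hQ _ hxy
    simpa [smul_smul, hh] using this
  constructor
  -- With `y` fixed, moving `x` by `w` changes the mean velocity by `-w / h`; the prefactor `h`
  -- cancels the `1 / h` and stays only in front of the derivative in the position.
  · have hs : HasFDerivAt (fun x' : V => ((x', h⁻¹ • (y - x')), k))
        (((ContinuousLinearMap.id ℝ V).prod (h⁻¹ • -ContinuousLinearMap.id ℝ V)).prod 0) x := by
      refine ((hasFDerivAt_id x).prodMk ?_).prodMk (hasFDerivAt_const k x)
      exact ((hasFDerivAt_id x).const_sub y).const_smul h⁻¹
    have h1 := (HasFDerivAt.comp (g := B) x hB.hasFDerivAt hs).const_mul h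
    have h2 : (fun x' => Q x' y) =ᶠ[𝓝 x] fun x' => h * B ((x', h⁻¹ • (y - x')), k) := by
      have hc : Continuous fun x' : V => (x', h⁻¹ • (y - x')) := by fun_prop
      filter_upwards [hc.continuousAt.eventually (hZ.mem_nhds hz)] with x' hx' using hQ' x' y hx'
    refine (h1.congr_of_eventuallyEq h2).congr_fderiv ?_
    ext w
    have hw : ((w, h⁻¹ • -w), (0 : ℝ)) =
        ((w, (0 : V)), (0 : ℝ)) - h⁻¹ • (((0 : V), w), (0 : ℝ)) := by
      simp
    simp only [derivFst, derivSnd, smul_apply, sub_apply,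
      ContinuousLinearMap.comp_apply, ContinuousLinearMap.prod_apply,
      neg_apply, ContinuousLinearMap.id_apply, zero_apply,
      ContinuousLinearMap.inl_apply, ContinuousLinearMap.inr_apply]
    rw [hw, map_sub, map_smul]
    simp only [smul_eq_mul]
    field_simp
  · have hs : HasFDerivAt (fun y' : V => ((x, h⁻¹ • (y' - x)), k))
        (((0 : V →L[ℝ] V).prod (h⁻¹ • ContinuousLinearMap.id ℝ V)).prod 0) y := by
      refine ((hasFDerivAt_const x y).prodMk ?_).prodMk (hasFDerivAt_const k y)
      exact ((hasFDerivAt_id y).sub_const x).const_smul h⁻¹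
    have h1 := (HasFDerivAt.comp (g := B) y hB.hasFDerivAt hs).const_mul h
    have h2 : (fun y' => Q x y') =ᶠ[𝓝 y] fun y' => h * B ((x, h⁻¹ • (y' - x)), k) := by
      have hc : Continuous fun y' : V => (x, h⁻¹ • (y' - x)) := by fun_prop
      filter_upwards [hc.continuousAt.eventually (hZ.mem_nhds hz)] with y' hy' using hQ' x y' hy'
    refine (h1.congr_of_eventuallyEq h2).congr_fderiv ?_
    ext w
    have hw : (((0 : V), h⁻¹ • w), (0 : ℝ)) = h⁻¹ • (((0 : V), w), (0 : ℝ)) := by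
      simp
    simp only [derivSnd, smul_apply,
      ContinuousLinearMap.comp_apply, ContinuousLinearMap.prod_apply,
      ContinuousLinearMap.id_apply, zero_apply,
      ContinuousLinearMap.inl_apply, ContinuousLinearMap.inr_apply]
    rw [hw, map_smul]
    simp only [smul_eq_mul]
    field_simp

end Factorization

/-! ### The generating function at zero step is the Lagrangian. -/

section Consistency

variable {V : Type*} [NormedAddCommGroup V] [InnerProductSpace ℝ V] [FiniteDimensional ℝ V]

theorem tendsto_inv_smul_sub {F : Type*} [NormedAddCommGroup F] [NormedSpace ℝ F] {δ : ℝ}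
    (hδ : 0 < δ) {f : ℝ → F} {f' : F} (hf : HasDerivWithinAt f f' (Icc 0 δ) 0) :
    Tendsto (fun h : ℝ => h⁻¹ • (f h - f 0)) (𝓝[>] 0) (𝓝 f') := by
  have h1 : HasDerivWithinAt f f' (Ioi 0) 0 :=
    hf.mono_of_mem_nhdsWithin (mem_of_superset (Ioc_mem_nhdsGT hδ) Ioc_subset_Icc_self)
  rw [hasDerivWithinAt_iff_tendsto_slope' self_notMem_Ioi] at h1
  refine h1.congr fun h => ?_
  rw [slope_def_module, sub_zero]

theorem tendsto_inv_mul_integral {φ : ℝ → ℝ} {δ : ℝ} (hδ : 0 < δ)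
    (hφ : ContinuousOn φ (Icc 0 δ)) :
    Tendsto (fun h : ℝ => h⁻¹ * ∫ t in (0 : ℝ)..h, φ t) (𝓝[>] 0) (𝓝 (φ 0)) := by
  have h0 : (0 : ℝ) ∈ Icc 0 δ := ⟨le_rfl, hδ.le⟩
  have : Fact ((0 : ℝ) ∈ Icc 0 δ) := ⟨h0⟩
  have h1 : HasDerivWithinAt (fun u => ∫ t in (0 : ℝ)..u, φ t) (φ 0) (Icc 0 δ) 0 :=
    intervalIntegral.integral_hasDerivWithinAt_right (by simp)
      (hφ.stronglyMeasurableAtFilter_nhdsWithin measurableSet_Icc 0) (hφ 0 h0)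
  simpa using tendsto_inv_smul_sub hδ h1

/-- If the action of short solutions is `h B(x, v, √h)`, where `x` is the initial point and `v` the
mean velocity, then `B` agrees with the Lagrangian at `h = 0`. -/
theorem eq_lagrangian_of_action_eq {ℓ : V × V → ℝ} {O W Z : Set (V × V)} (hO : IsOpen O)
    (hℓ : ContDiffOn ℝ ∞ ℓ O) (hZ : IsOpen Z) (hZO : Z ⊆ O) (hreg : RegularOn ℓ Z) (hZW : Z ⊆ W)
    {a : ℝ} (ha : 0 < a) {B : (V × V) × ℝ → ℝ} (hB : ContinuousOn B (Z ×ˢ Ioo (-a) a))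
    (hact : ∀ h, 0 < h → √h < a → ∀ γ : ℝ → V, IsEulerLagrange ℓ W h γ →
      (γ 0, h⁻¹ • (γ h - γ 0)) ∈ Z →
      ∫ t in (0 : ℝ)..h, ℓ (jet h γ t) = h * B ((γ 0, h⁻¹ • (γ h - γ 0)), √h))
    {z : V × V} (hz : z ∈ Z) (hWO : W ⊆ O) : B (z, 0) = ℓ z := by
  obtain ⟨δ, hδ, γ, hγ, hγ0⟩ := exists_isEulerLagrange hO hℓ hZ hZO hreg hZW hz
  have hjc := continuousOn_jet hδ hγ.1.1
  have h0 : (0 : ℝ) ∈ Icc 0 δ := ⟨le_rfl, hδ.le⟩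
  have hφ : ContinuousOn (fun t => ℓ (jet δ γ t)) (Icc 0 δ) :=
    hℓ.continuousOn.comp hjc fun t ht => hWO (hγ.1.2 t ht)
  have hγz : γ 0 = z.1 := congrArg Prod.fst hγ0
  have hd : HasDerivWithinAt γ z.2 (Icc 0 δ) 0 := by
    have := ((hγ.1.1.differentiableOn (by norm_num)) 0 h0).hasDerivWithinAt
    rwa [show derivWithin γ (Icc 0 δ) 0 = z.2 from congrArg Prod.snd hγ0] at this
  have hv := tendsto_inv_smul_sub hδ hd
  have hk : Tendsto (fun h : ℝ => √h) (𝓝[>] 0) (𝓝 0) := by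
    simpa using (Real.continuous_sqrt.tendsto 0).mono_left nhdsWithin_le_nhds
  have hq : Tendsto (fun h : ℝ => ((γ 0, h⁻¹ • (γ h - γ 0)), √h)) (𝓝[>] 0) (𝓝 (z, 0)) := by
    refine Tendsto.prodMk_nhds ?_ hk
    exact Tendsto.prodMk_nhds (hγz ▸ tendsto_const_nhds) hv
  have hO' : IsOpen (Z ×ˢ Ioo (-a) a) := hZ.prod isOpen_Ioo
  have hm : (z, (0 : ℝ)) ∈ Z ×ˢ Ioo (-a) a := ⟨hz, by linarith, ha⟩
  -- On shorter and shorter initial pieces of one solution, `B` equals the time average of the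
  -- Lagrangian. The left side tends to `B (z, 0)` because the mean velocity tends to `z.2`, the
  -- average tends to `ℓ z`.
  have h1 := (hB.continuousAt (hO'.mem_nhds hm)).tendsto.comp hq
  have h2 := tendsto_inv_mul_integral hδ hφ
  rw [hγ0] at h2
  refine tendsto_nhds_unique (h1.congr' ?_) h2
  filter_upwards [hq.eventually (hO'.mem_nhds hm), Ioo_mem_nhdsGT hδ] with h hhm hhδ
  have hres := hγ.comp_add hhδ.1 le_rfl (by linarith [hhδ.2])
  simp only [add_zero] at hres
  have h3 := hact h hhδ.1 hhm.2.2 γ hres hhm.1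
  have h4 : ∫ t in (0 : ℝ)..h, ℓ (jet h γ t) = ∫ t in (0 : ℝ)..h, ℓ (jet δ γ t) := by
    refine intervalIntegral.integral_congr fun t ht => ?_
    rw [uIcc_of_le hhδ.1.le] at ht
    have := jet_comp_add hhδ.1 le_rfl (by linarith [hhδ.2]) hγ.1.1 ht
    simp only [add_zero] at this
    exact congrArg ℓ this
  rw [← h4, h3, ← mul_assoc, inv_mul_cancel₀ hhδ.1.ne', one_mul]
  rfl

end Consistency

/-! ### Bounds for one step, uniform over compact sets of initial states. -/

section OneStep

variable {V : Type*} [NormedAddCommGroup V] [InnerProductSpace ℝ V]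

/-- The negative of the first partial derivative of `h B(x, (y - x) / h, k)`, where `h = k²`. -/
noncomputable def generatedMomentum (B : (V × V) × ℝ → ℝ) (q : (V × V) × ℝ) : V →L[ℝ] ℝ :=
  derivSnd B q - q.2 ^ 2 • derivFst B q

theorem contDiffOn_derivSnd {S : Set ((V × V) × ℝ)} (hS : IsOpen S) {F : Type*}
    [NormedAddCommGroup F] [NormedSpace ℝ F] {B : (V × V) × ℝ → F}
    (hB : ContDiffOn ℝ ∞ B S) : ContDiffOn ℝ ∞ (derivSnd B) S :=
  (hB.fderiv_of_isOpen hS (by simp)).clm_comp contDiffOn_const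

theorem contDiffOn_derivFst {S : Set ((V × V) × ℝ)} (hS : IsOpen S) {F : Type*}
    [NormedAddCommGroup F] [NormedSpace ℝ F] {B : (V × V) × ℝ → F}
    (hB : ContDiffOn ℝ ∞ B S) : ContDiffOn ℝ ∞ (derivFst B) S :=
  (hB.fderiv_of_isOpen hS (by simp)).clm_comp contDiffOn_const

theorem contDiffOn_generatedMomentum {S : Set ((V × V) × ℝ)} (hS : IsOpen S)
    {B : (V × V) × ℝ → ℝ} (hB : ContDiffOn ℝ ∞ B S) :
    ContDiffOn ℝ ∞ (generatedMomentum B) S :=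
  (contDiffOn_derivSnd hS hB).sub
    ((by fun_prop : ContDiff ℝ ∞ fun q : (V × V) × ℝ => q.2 ^ 2).contDiffOn.smul
      (contDiffOn_derivFst hS hB))

/-- The mean value inequality for `γ t - t • z.2`, whose derivative is at most `ε`. -/
theorem norm_mean_velocity_sub_le {H s h : ℝ} (hh : 0 < h) (hs : 0 ≤ s) (hsH : s + h ≤ H)
    {γ : ℝ → V} (hγ : ContDiffOn ℝ 2 γ (Icc 0 H)) {z : V × V} {ε : ℝ}
    (hε : ∀ t ∈ Icc 0 H, ‖jet H γ t - z‖ ≤ ε) :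
    ‖h⁻¹ • (γ (s + h) - γ s) - z.2‖ ≤ ε := by
  have hsub : Icc s (s + h) ⊆ Icc 0 H := fun t ht => ⟨hs.trans ht.1, ht.2.trans hsH⟩
  have h1 := (convex_Icc s (s + h)).norm_image_sub_le_of_norm_hasDerivWithin_le
    (f := fun t => γ t - t • z.2) (f' := fun t => derivWithin γ (Icc 0 H) t - z.2) (C := ε)
    (fun t ht => ?_) (fun t ht => ?_) (left_mem_Icc.2 (by linarith)) (right_mem_Icc.2 (by linarith))
  · have h2 : h⁻¹ • (γ (s + h) - γ s) - z.2 =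
        h⁻¹ • (γ (s + h) - (s + h) • z.2 - (γ s - s • z.2)) := by
      have : γ (s + h) - (s + h) • z.2 - (γ s - s • z.2) = (γ (s + h) - γ s) - h • z.2 := by
        rw [add_smul]; abel
      rw [this, smul_sub h⁻¹ (γ (s + h) - γ s), smul_smul, inv_mul_cancel₀ hh.ne', one_smul]
    rw [h2, norm_smul, norm_inv, Real.norm_of_nonneg hh.le, inv_mul_le_iff₀ hh]
    rw [add_sub_cancel_left, Real.norm_of_nonneg hh.le] at h1
    linarith
  · have h2 := ((hγ.differentiableOn (by norm_num)) t (hsub ht)).hasDerivWithinAt.mono hsub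
    have h3 : HasDerivWithinAt (fun t : ℝ => t • z.2) z.2 (Icc s (s + h)) t := by
      simpa using ((hasDerivAt_id t).smul_const z.2).hasDerivWithinAt
    exact h2.sub h3
  · exact (norm_snd_le (jet H γ t - z)).trans (hε t (hsub ht))

/-- Bounds that hold uniformly for initial states `z` in `K` and small steps `h`. -/
structure UniformBounds (ℓ : V × V → ℝ) (W Z : Set (V × V)) (B R : (V × V) × ℝ → ℝ)
    (K : Set (V × V)) (C r M h₁ : ℝ) : Prop where
  nonneg : 0 ≤ M
  flow : ∀ h ∈ Ioo 0 h₁, ∀ z ∈ K, ∀ H ≤ 2 * h, 0 < H → ∀ γ : ℝ → V, IsEulerLagrange ℓ W H γ →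
    jet H γ 0 = z → ∀ t ∈ Icc 0 H, ‖jet H γ t - z‖ ≤ M * h
  small : ∀ h ∈ Ioo 0 h₁, M * h ≤ r
  mem : ∀ h ∈ Ioo 0 h₁, ∀ z ∈ K, ∀ x u, ‖x - z.1‖ ≤ M * h → ‖u - z.2‖ ≤ r → (x, u) ∈ Z
  mem_step : ∀ h ∈ Ioo 0 h₁, ∀ z ∈ K, ∀ x u, ‖x - z.1‖ ≤ M * h → ‖u - z.2‖ ≤ r →
    (x + h • u, z.2) ∈ Z
  inverse : ∀ h ∈ Ioo 0 h₁, ∀ z ∈ K, ∀ x u u', ‖x - z.1‖ ≤ M * h → ‖u - z.2‖ ≤ r →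
    ‖u' - z.2‖ ≤ r →
    ‖u - u'‖ ≤ C * ‖generatedMomentum B ((x, u), √h) - generatedMomentum B ((x, u'), √h)‖
  lipschitz : ∀ h ∈ Ioo 0 h₁, ∀ z ∈ K, ∀ x u u', ‖x - z.1‖ ≤ M * h → ‖u - z.2‖ ≤ r →
    ‖u' - z.2‖ ≤ r → ‖derivFst B ((x, u), √h) - derivFst B ((x, u'), √h)‖ ≤ C * ‖u - u'‖
  bound_snd : ∀ h ∈ Ioo 0 h₁, ∀ z ∈ K, ∀ x u, ‖x - z.1‖ ≤ M * h → ‖u - z.2‖ ≤ r →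
    ‖derivSnd R ((x, u), √h)‖ ≤ C
  bound_fst : ∀ h ∈ Ioo 0 h₁, ∀ z ∈ K, ∀ x u, ‖x - z.1‖ ≤ M * h → ‖u - z.2‖ ≤ r →
    ‖derivFst R ((x, u), √h)‖ ≤ C
  exists_phase : ∀ h ∈ Ioo 0 h₁, ∀ z ∈ K, ∃ u, ‖u - z.2‖ ≤ r ∧
    generatedMomentum B ((z.1, u), √h) = generatedMomentum B (z, 0)
  exists_update : ∀ h ∈ Ioo 0 h₁, ∀ z ∈ K, ∀ x x' v, ‖x - z.1‖ ≤ M * h → ‖x' - z.1‖ ≤ M * h →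
    ‖v - z.2‖ ≤ M * h → ∃ u, ‖u - z.2‖ ≤ r ∧
      generatedMomentum B ((x, u), √h) = derivSnd B ((x', v), √h)

theorem eventually_nhdsGT_lt {f : ℝ → ℝ} (hf : Continuous f) {c : ℝ} (h : f 0 < c) :
    ∀ᶠ t in 𝓝[>] 0, f t < c :=
  nhdsWithin_le_nhds (hf.continuousAt.eventually (gt_mem_nhds h))

variable [FiniteDimensional ℝ V]

theorem exists_uniformBounds {ℓ : V × V → ℝ} {O W Z : Set (V × V)} (hO : IsOpen O)
    (hℓ : ContDiffOn ℝ ∞ ℓ O) (hZ : IsOpen Z) (hZO : Z ⊆ O) (hreg : RegularOn ℓ Z)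
    {a : ℝ} (ha : 0 < a) {B R : (V × V) × ℝ → ℝ} (hB : ContDiffOn ℝ ∞ B (Z ×ˢ Ioo (-a) a))
    (hR : ContDiffOn ℝ ∞ R (Z ×ˢ Ioo (-a) a))
    (hB0 : ∀ z ∈ Z, generatedMomentum B (z, 0) = momentum ℓ z)
    {K : Set (V × V)} (hK : IsCompact K) (hKZ : K ⊆ Z) {ε : ℝ} (hε : 0 < ε) :
    ∃ C r M h₁, 0 < C ∧ 0 < r ∧ 0 < h₁ ∧ h₁ ≤ ε ∧ UniformBounds ℓ W Z B R K C r M h₁ := by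
  have hO' : IsOpen (Z ×ˢ Ioo (-a) a) := hZ.prod isOpen_Ioo
  have h0I : (0 : ℝ) ∈ Ioo (-a) a := ⟨by linarith, ha⟩
  have hΨ := contDiffOn_generatedMomentum hO' hB
  obtain ⟨ρ₀, hρ₀, hρZ⟩ := hK.exists_cthickening_subset_open hZ hKZ
  set K₁ := cthickening ρ₀ K with hK₁
  have hK₁c : IsCompact K₁ := hK.cthickening
  have hmem : ∀ z ∈ K, ∀ x u, ‖x - z.1‖ ≤ ρ₀ → ‖u - z.2‖ ≤ ρ₀ → (x, u) ∈ K₁ := by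
    intro z hz x u hx hu
    refine mem_cthickening_of_dist_le _ z _ _ hz ?_
    rw [Prod.dist_eq, dist_eq_norm, dist_eq_norm]
    exact max_le hx hu
  -- At `k = 0` the generated momentum is that of the Lagrangian, so its velocity derivative is the
  -- second derivative that `RegularOn` makes injective.
  have hinj : ∀ z ∈ Z, Function.Injective (derivSnd (generatedMomentum B) (z, 0)) := by
    intro z hz
    have h1 := hasFDerivAt_derivSnd (x := z.1) (v := z.2) (k := 0)
      ((hΨ.differentiableOn (by simp)).differentiableAt (hO'.mem_nhds ⟨hz, h0I⟩))
    have h2 : (fun u => momentum ℓ (z.1, u)) =ᶠ[𝓝 z.2]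
        fun u => generatedMomentum B ((z.1, u), 0) := by
      have hc : Continuous fun u : V => (z.1, u) := by fun_prop
      filter_upwards [hc.continuousAt.eventually (hZ.mem_nhds hz)] with u hu using (hB0 _ hu).symm
    have h3 := hreg z hz
    rwa [(h1.congr_of_eventuallyEq h2).fderiv] at h3
  -- The thickening `K₁` replaces `K` because the base point of the second step has drifted from the
  -- initial point by up to `M * h`.
  obtain ⟨C₀, r, k₁, ρ, hC₀, hr, hrρ, hk₁, hk₁a, hρ, hinv⟩ := exists_uniform_inverse hZ ha
    (hΨ.of_le (by simp)) hinj hK₁c hρZ hρ₀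
  obtain ⟨M₀, h₂, hM₀, hh₂, hflow⟩ := exists_norm_jet_sub_le (W := W) hO hℓ hZ hZO hreg hK hKZ
  set Q : Set ((V × V) × ℝ) := K₁ ×ˢ Icc (-(a / 2)) (a / 2) with hQ
  have hQc : IsCompact Q := hK₁c.prod isCompact_Icc
  have hQO : Q ⊆ Z ×ˢ Ioo (-a) a := by
    rintro ⟨z, k⟩ ⟨hz, hk⟩
    exact ⟨hρZ hz, by linarith [hk.1], by linarith [hk.2]⟩
  obtain ⟨C₁, hC₁⟩ := hQc.exists_bound_of_continuousOn
    ((contDiffOn_derivSnd hO' hR).continuousOn.mono hQO)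
  obtain ⟨C₂, hC₂⟩ := hQc.exists_bound_of_continuousOn
    ((contDiffOn_derivFst hO' hR).continuousOn.mono hQO)
  have hBx := contDiffOn_derivFst hO' hB
  obtain ⟨C₃, hC₃⟩ := hQc.exists_bound_of_continuousOn
    ((contDiffOn_derivSnd hO' hBx).continuousOn.mono hQO)
  have hu := hQc.uniformContinuousOn_of_continuous
    ((contDiffOn_derivSnd hO' hB).continuousOn.mono hQO)
  rw [Metric.uniformContinuousOn_iff] at hu
  obtain ⟨δ, hδ, hδB⟩ := hu ρ hρ
  obtain ⟨N, hN⟩ := hK.exists_bound_of_continuousOn (continuous_snd.continuousOn (s := K))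
  -- Solutions are followed up to time `2 * h`, so the drift `M₀ * t` is at most `M * h`.
  set M := 2 * M₀ with hM
  have hev : ∀ᶠ h : ℝ in 𝓝[>] 0, (√h < k₁ ∧ √h < a / 2 ∧ √h < δ) ∧
      (M * h < r ∧ M * h < ρ₀ ∧ 2 * (M * h) < δ) ∧
      (M * h + h * (N + r) < ρ₀ ∧ 2 * h < h₂ ∧ h < ε) := by
    have hs := Real.continuous_sqrt
    have hc : Continuous fun h : ℝ => M * h := by fun_prop
    refine ((eventually_nhdsGT_lt hs (by simpa)).and ((eventually_nhdsGT_lt hs (by simpa)).and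
      (eventually_nhdsGT_lt hs (by simpa)))).and
      (((eventually_nhdsGT_lt hc (by simpa)).and ((eventually_nhdsGT_lt hc (by simpa)).and
      (eventually_nhdsGT_lt (by fun_prop) (by simpa)))).and
      ((eventually_nhdsGT_lt (by fun_prop) (by simpa)).and
      ((eventually_nhdsGT_lt (by fun_prop) (by simpa)).and
      (eventually_nhdsGT_lt continuous_id (by simpa)))))
  obtain ⟨h₃, hh₃, hsub⟩ := mem_nhdsGT_iff_exists_Ioo_subset.1 hev
  replace hh₃ : 0 < h₃ := hh₃
  have hQm : ∀ h ∈ Ioo 0 h₃, ∀ z ∈ K, ∀ x u, ‖x - z.1‖ ≤ M * h → ‖u - z.2‖ ≤ r →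
      ((x, u), √h) ∈ Q := by
    intro h hh z hz x u hx hu
    obtain ⟨⟨-, h1, -⟩, ⟨-, h2, -⟩, -⟩ := hsub hh
    exact ⟨hmem z hz x u (hx.trans h2.le) (hu.trans hrρ),
      by linarith [Real.sqrt_nonneg h], h1.le⟩
  have hbase : ∀ h ∈ Ioo 0 h₃, ∀ z ∈ K, ∀ x, ‖x - z.1‖ ≤ M * h → (x, z.2) ∈ K₁ :=
    fun h hh z hz x hx => (hQm h hh z hz x z.2 hx (by simpa using hr.le)).1
  have hk : ∀ h ∈ Ioo 0 h₃, |√h| < k₁ := fun h hh => by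
    rw [abs_of_nonneg (Real.sqrt_nonneg h)]; exact (hsub hh).1.1
  refine ⟨max C₀ (max C₁ (max C₂ C₃)), r, M, min h₃ ε, by positivity, hr, by positivity,
    min_le_right _ _, ?_⟩
  have hI : Ioo 0 (min h₃ ε) ⊆ Ioo 0 h₃ := Ioo_subset_Ioo_right (min_le_left _ _)
  constructor
  · positivity
  · intro h hh z hz H hH hH0 γ hγ hγz t ht
    have h1 := hflow H ⟨hH0, hH.trans_lt (hsub (hI hh)).2.2.2.1⟩ γ hγ (hγz ▸ hz) t ht
    rw [hγz] at h1
    refine h1.trans ?_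
    have : M₀ * t ≤ M₀ * (2 * h) := mul_le_mul_of_nonneg_left (ht.2.trans hH) hM₀.le
    linarith
  · exact fun h hh => (hsub (hI hh)).2.1.1.le
  · exact fun h hh z hz x u hx hu => hρZ (hQm h (hI hh) z hz x u hx hu).1
  · intro h hh z hz x u hx hu
    refine hρZ (hmem z hz _ _ ?_ (by simpa using hρ₀.le))
    have h1 : ‖u‖ ≤ N + r := by
      have := norm_add_le z.2 (u - z.2)
      rw [add_sub_cancel] at this
      linarith [hN z hz]
    calc ‖x + h • u - z.1‖ = ‖(x - z.1) + h • u‖ := by abel_nf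
      _ ≤ M * h + h * (N + r) := by
        refine norm_add_le_of_le hx ?_
        rw [norm_smul, Real.norm_of_nonneg hh.1.le]
        exact mul_le_mul_of_nonneg_left h1 hh.1.le
      _ ≤ ρ₀ := (hsub (hI hh)).2.2.1.le
  · intro h hh z hz x u u' hx hu hu'
    refine ((hinv (x, z.2) (hbase h (hI hh) z hz x hx) (√h) (hk h (hI hh))).1 u u' hu hu').trans ?_
    exact mul_le_mul_of_nonneg_right (le_max_left _ _) (norm_nonneg _)
  · intro h hh z hz x u u' hx hu hu'
    have h1 := (convex_closedBall z.2 r).norm_image_sub_le_of_norm_hasFDerivWithin_le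
      (f := fun u => derivFst B ((x, u), √h)) (f' := fun u => derivSnd (derivFst B) ((x, u), √h))
      (C := C₃) (x := u') (y := u) ?_ ?_ (by rwa [mem_closedBall, dist_eq_norm])
      (by rwa [mem_closedBall, dist_eq_norm])
    · refine h1.trans (mul_le_mul_of_nonneg_right ?_ (norm_nonneg _))
      exact (le_max_right _ _).trans ((le_max_right _ _).trans (le_max_right _ _))
    · intro y hy
      rw [mem_closedBall, dist_eq_norm] at hy
      exact (hasFDerivAt_derivSnd ((hBx.differentiableOn (by simp)).differentiableAt
        (hO'.mem_nhds (hQO (hQm h (hI hh) z hz x y hx hy))))).hasFDerivWithinAt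
    · intro y hy
      rw [mem_closedBall, dist_eq_norm] at hy
      exact hC₃ _ (hQm h (hI hh) z hz x y hx hy)
  · exact fun h hh z hz x u hx hu => (hC₁ _ (hQm h (hI hh) z hz x u hx hu)).trans
      ((le_max_left _ _).trans (le_max_right _ _))
  · exact fun h hh z hz x u hx hu => (hC₂ _ (hQm h (hI hh) z hz x u hx hu)).trans
      ((le_max_left _ _).trans ((le_max_right _ _).trans (le_max_right _ _)))
  · intro h hh z hz
    exact (hinv z (self_subset_cthickening K hz) (√h) (hk h (hI hh))).2 _ (by simpa using hρ.le)
  · intro h hh z hz x x' v hx hx' hv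
    refine (hinv (x, z.2) (hbase h (hI hh) z hz x hx) (√h) (hk h (hI hh))).2
      (derivSnd B ((x', v), √h)) ?_
    obtain ⟨⟨-, h1, h2⟩, ⟨h3, -, h4⟩, -⟩ := hsub (hI hh)
    -- The momentum to be matched is a value of `derivSnd B`; at `k = 0` the term with `derivFst B`
    -- drops out, so uniform continuity of `derivSnd B` puts the target within `ρ` of the centre.
    have h5 : generatedMomentum B ((x, z.2), 0) = derivSnd B ((x, z.2), 0) := by
      simp [generatedMomentum]
    rw [h5, ← dist_eq_norm]
    have hxQ : ((x, z.2), (0 : ℝ)) ∈ Q :=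
      ⟨hbase h (hI hh) z hz x hx, by linarith, by linarith⟩
    refine (hδB ((x', v), √h) (hQm h (hI hh) z hz x' v hx' (hv.trans h3.le)) ((x, z.2), 0)
      hxQ ?_).le
    have hMh : 0 ≤ M * h := (norm_nonneg _).trans hx
    rw [Prod.dist_eq, Prod.dist_eq]
    refine max_lt (max_lt ?_ ?_) ?_
    · calc dist x' x ≤ dist x' z.1 + dist x z.1 := dist_triangle_right _ _ _
        _ ≤ M * h + M * h := by rw [dist_eq_norm, dist_eq_norm]; exact add_le_add hx' hx
        _ < δ := by linarith
    · rw [dist_eq_norm]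
      exact hv.trans_lt (by linarith)
    · rw [Real.dist_eq, sub_zero, abs_of_nonneg (Real.sqrt_nonneg h)]
      exact h2

end OneStep

/-! ### From generating functions to the one-step errors. -/

section ErrorOrder

variable {E : Type*} [NormedAddCommGroup E] [NormedSpace ℝ E]
  {V : Type*} [NormedAddCommGroup V] [InnerProductSpace ℝ V]
  {G : Type*} [TopologicalSpace G] [ChartedSpace E G]

theorem norm_inv_smul_sub_sub_le_iff {h r : ℝ} (hh : 0 < h) (x y v : V) :
    ‖h⁻¹ • (y - x) - v‖ ≤ r ↔ ‖y - x - h • v‖ ≤ r * h := by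
  have h1 : y - x - h • v = h • (h⁻¹ • (y - x) - v) := by
    rw [smul_sub h (h⁻¹ • (y - x)), smul_smul, mul_inv_cancel₀ hh.ne', one_smul]
  rw [h1, norm_smul, Real.norm_of_nonneg hh.le, mul_comm r, mul_le_mul_iff_right₀ hh]

/-- The gain of one power: end points reached from the same `x` differ by `h` times the difference
of the mean velocities. -/
theorem norm_sub_le_of_norm_mean_velocity_sub_le {h c : ℝ} {n : ℕ} (hh : 0 < h) {x y y' : V}
    (hu : ‖h⁻¹ • (y - x) - h⁻¹ • (y' - x)‖ ≤ c * h ^ n) : ‖y - y'‖ ≤ c * h ^ (n + 1) := by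
  rw [← smul_sub, sub_sub_sub_cancel_right, norm_smul, norm_inv, Real.norm_of_nonneg hh.le,
    inv_mul_le_iff₀ hh] at hu
  rw [pow_succ]
  linarith

/-- `Ld` has the generating function `h B(x, v, √h)`, with `v` the mean velocity. -/
def HasGeneratingFunction (Ld : G → G → ℝ → ℝ) (χ : V → G) (Z : Set (V × V)) (a : ℝ)
    (B : (V × V) × ℝ → ℝ) : Prop :=
  ∀ h, 0 < h → √h < a → ∀ x y : V, (x, h⁻¹ • (y - x)) ∈ Z →
    partialOne Ld χ h x y = -generatedMomentum B ((x, h⁻¹ • (y - x)), √h) ∧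
    partialTwo Ld χ h x y = derivSnd B ((x, h⁻¹ • (y - x)), √h)

/-- The momenta along solutions are generated by `h (B + hⁿ R)`. -/
def GeneratesMomenta (ℓ : V × V → ℝ) (W Z : Set (V × V)) (a : ℝ) (n : ℕ)
    (B R : (V × V) × ℝ → ℝ) : Prop :=
  ∀ h, 0 < h → √h < a → ∀ γ : ℝ → V, IsEulerLagrange ℓ W h γ →
    (γ 0, h⁻¹ • (γ h - γ 0)) ∈ Z →
    momentum ℓ (jet h γ 0) = generatedMomentum B ((γ 0, h⁻¹ • (γ h - γ 0)), √h) +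
      h ^ n • (derivSnd R ((γ 0, h⁻¹ • (γ h - γ 0)), √h) -
        h • derivFst R ((γ 0, h⁻¹ • (γ h - γ 0)), √h)) ∧
    momentum ℓ (jet h γ h) = derivSnd B ((γ 0, h⁻¹ • (γ h - γ 0)), √h) +
      h ^ n • derivSnd R ((γ 0, h⁻¹ • (γ h - γ 0)), √h)

theorem norm_pow_smul_sub_le {F : Type*} [NormedAddCommGroup F] [NormedSpace ℝ F] {h C : ℝ}
    (hh : 0 < h) (hh1 : h ≤ 1) (n : ℕ) {p q : F} (hp : ‖p‖ ≤ C) (hq : ‖q‖ ≤ C) :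
    ‖h ^ n • (p - h • q)‖ ≤ 2 * C * h ^ n := by
  have hC : 0 ≤ C := (norm_nonneg p).trans hp
  have h1 : ‖p - h • q‖ ≤ 2 * C := by
    calc ‖p - h • q‖ ≤ ‖p‖ + ‖h • q‖ := norm_sub_le _ _
      _ ≤ C + 1 * C := by
        rw [norm_smul, Real.norm_of_nonneg hh.le]
        exact add_le_add hp (mul_le_mul hh1 hq (norm_nonneg _) zero_le_one)
      _ = 2 * C := by ring
  rw [norm_smul, norm_pow, Real.norm_of_nonneg hh.le, mul_comm]
  exact mul_le_mul_of_nonneg_right h1 (by positivity)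

theorem sqrt_sq_eq_of_pos {h : ℝ} (hh : 0 < h) : √h ^ 2 = h := Real.sq_sqrt hh.le

variable [FiniteDimensional ℝ V] {L : TangentBundle 𝓘(ℝ, E) G → ℝ} {χ : V → G}
  {O W Z : Set (V × V)} (hO : IsOpen O) (hℓ : ContDiffOn ℝ ∞ (coordLagrangian L χ) O)
  (hZ : IsOpen Z) (hZO : Z ⊆ O) (hZW : Z ⊆ W) (hreg : RegularOn (coordLagrangian L χ) Z)
  {eG : G → G → ℝ} {CG : ℝ} (hCG : 0 ≤ CG)
  (hcondG : ∀ z ∈ W, ∀ z' ∈ W, eG (χ z.1) (χ z'.1) ≤ CG * ‖z.1 - z'.1‖)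
  {a : ℝ} (ha : 0 < a) {n : ℕ} {B R : (V × V) × ℝ → ℝ}
  (hB : ContDiffOn ℝ ∞ B (Z ×ˢ Ioo (-a) a)) (hR : ContDiffOn ℝ ∞ R (Z ×ˢ Ioo (-a) a))
  (hB0 : ∀ z ∈ Z, generatedMomentum B (z, 0) = momentum (coordLagrangian L χ) z)
  {Ld : G → G → ℝ → ℝ} (hLd : HasGeneratingFunction Ld χ Z a B)
  (hE : GeneratesMomenta (coordLagrangian L χ) W Z a n B R)

include hO hℓ hZ hZO hZW hreg hCG hcondG ha hB hR hB0 hLd hE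

/-- The discrete mean velocity `u` and the exact one `v` give the same initial momentum, through `B`
and through `B + h ^ n R` respectively. Uniform invertibility turns the discrepancy `h ^ n` into a
bound for `u - v`. -/
theorem phaseMapErrorBigO_of_generating : PhaseMapErrorBigO L χ W Z eG Ld (n + 1) := by
  intro K hKZ hK
  obtain ⟨C, r, M, h₁, hC, hr, hh₁, hh₁ε, hu⟩ := exists_uniformBounds (W := W) hO hℓ hZ hZO hreg ha
    hB hR hB0 hK hKZ (ε := min (a ^ 2) 1) (by positivity)
  -- One factor `C` bounds the inverse; `2 * C` bounds the two derivatives of `R` in the generated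
  -- momentum.
  set c := C * (2 * C) with hc
  have hc0 : 0 ≤ c := by positivity
  refine ⟨c + CG * c + (C * c + C), r, h₁, hr, hh₁, fun h hh z hz => ?_⟩
  have hpos := hh.1
  have hha : √h < a := by
    rw [Real.sqrt_lt' ha]
    exact hh.2.trans_le (hh₁ε.trans (min_le_left _ _))
  have hh1 : h ≤ 1 := hh.2.le.trans (hh₁ε.trans (min_le_right _ _))
  have hhn : 0 ≤ h ^ (n + 1) := by positivity
  have hsq := sqrt_sq_eq_of_pos hpos
  refine ⟨?_, ?_⟩
  · obtain ⟨u, hur, hup⟩ := hu.exists_phase h hh z hz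
    have huy : h⁻¹ • (z.1 + h • u - z.1) = u := by
      rw [add_sub_cancel_left, smul_smul, inv_mul_cancel₀ hpos.ne', one_smul]
    have hM : 0 ≤ M * h := mul_nonneg hu.nonneg hpos.le
    refine ⟨z.1 + h • u, ?_, ?_⟩
    · rw [← norm_inv_smul_sub_sub_le_iff hpos, huy]
      exact hur
    · rw [(hLd h hpos hha z.1 _ (by
        rw [huy]; exact hu.mem h hh z hz z.1 u (by simpa using hM) hur)).1, huy, neg_neg, hup,
        hB0 z (hKZ hz)]
  · intro γ hγ hγz y hyr hy
    have hflow := hu.flow h hh z hz h (by linarith) hpos γ hγ hγz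
    have hM : 0 ≤ M * h := (norm_nonneg _).trans (hflow 0 ⟨le_rfl, hpos.le⟩)
    have hM' : ‖z.1 - z.1‖ ≤ M * h := by simpa using hM
    have hγ0 : γ 0 = z.1 := congrArg Prod.fst hγz
    set u := h⁻¹ • (y - z.1) with hudef
    set v := h⁻¹ • (γ h - z.1) with hvdef
    have hur : ‖u - z.2‖ ≤ r := (norm_inv_smul_sub_sub_le_iff hpos _ _ _).2 hyr
    have hvr : ‖v - z.2‖ ≤ r := by
      have := norm_mean_velocity_sub_le hpos le_rfl (zero_add h).le hγ.1.1 hflow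
      rw [zero_add, hγ0] at this
      exact this.trans (hu.small h hh)
    have huZ : (z.1, u) ∈ Z := hu.mem h hh z hz z.1 u hM' hur
    have hvZ : (z.1, v) ∈ Z := hu.mem h hh z hz z.1 v hM' hvr
    obtain ⟨hE0, hEh⟩ := hE h hpos hha γ hγ (by rw [hγ0]; exact hvZ)
    obtain ⟨hL1, hL2⟩ := hLd h hpos hha z.1 y huZ
    rw [hγ0, ← hvdef, hγz] at hE0
    rw [hγ0, ← hvdef] at hEh
    rw [hL1, neg_neg, ← hudef] at hy
    have hRs := hu.bound_snd h hh z hz z.1 v hM' hvr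
    have hRf := hu.bound_fst h hh z hz z.1 v hM' hvr
    have huv : ‖u - v‖ ≤ c * h ^ n := by
      have h1 := hu.inverse h hh z hz z.1 u v hM' hur hvr
      rw [hy, hE0, add_sub_cancel_left] at h1
      refine h1.trans ?_
      rw [hc, mul_assoc]
      exact mul_le_mul_of_nonneg_left (norm_pow_smul_sub_le hpos hh1 n hRs hRf) hC.le
    have hyγ : ‖y - γ h‖ ≤ c * h ^ (n + 1) := norm_sub_le_of_norm_mean_velocity_sub_le hpos huv
    refine ⟨hyγ.trans (mul_le_mul_of_nonneg_right ?_ hhn), ?_, ?_⟩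
    · nlinarith [mul_nonneg hCG hc0, mul_nonneg hC.le hc0]
    -- The bound on `eG` needs `y` paired with some velocity in `W`; the initial velocity serves.
    · have hyW : (y, z.2) ∈ W := by
        have := hu.mem_step h hh z hz z.1 u hM' hur
        rw [hudef, smul_smul, mul_inv_cancel₀ hpos.ne', one_smul, add_sub_cancel] at this
        exact hZW this
      refine (hcondG _ hyW _ (hγ.1.2 h ⟨hpos.le, le_rfl⟩)).trans ?_
      refine (mul_le_mul_of_nonneg_left hyγ hCG).trans ?_
      rw [← mul_assoc]
      exact mul_le_mul_of_nonneg_right (by nlinarith [mul_nonneg hC.le hc0]) hhn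
    -- Comparing the values of `derivSnd B` directly would give only `h ^ n`. Expressing both final
    -- momenta by the common initial one cancels the `h ^ n` term in `derivSnd R`; every remaining
    -- term carries an extra factor `h`.
    · have h1 : derivSnd B ((z.1, u), √h) =
          momentum (coordLagrangian L χ) z + h • derivFst B ((z.1, u), √h) := by
        rw [← hy, generatedMomentum, hsq, sub_add_cancel]
      have h2 : momentum (coordLagrangian L χ) (jet h γ h) =
          momentum (coordLagrangian L χ) z + h • derivFst B ((z.1, v), √h) +
            h ^ (n + 1) • derivFst R ((z.1, v), √h) := by
        rw [hEh, hE0, generatedMomentum, hsq]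
        simp only [smul_sub, smul_smul, pow_succ]
        abel
      have h3 : derivSnd B ((z.1, u), √h) - momentum (coordLagrangian L χ) (jet h γ h) =
          h • (derivFst B ((z.1, u), √h) - derivFst B ((z.1, v), √h)) -
            h ^ (n + 1) • derivFst R ((z.1, v), √h) := by
        rw [h1, h2, smul_sub]
        abel
      rw [hL2, ← hudef, h3]
      have h4 : ‖h • (derivFst B ((z.1, u), √h) - derivFst B ((z.1, v), √h))‖ ≤
          C * c * h ^ (n + 1) := by
        rw [norm_smul, Real.norm_of_nonneg hpos.le]
        calc h * ‖derivFst B ((z.1, u), √h) - derivFst B ((z.1, v), √h)‖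
            ≤ h * (C * (c * h ^ n)) := by
              refine mul_le_mul_of_nonneg_left ?_ hpos.le
              exact (hu.lipschitz h hh z hz z.1 u v hM' hur hvr).trans
                (mul_le_mul_of_nonneg_left huv hC.le)
          _ = C * c * h ^ (n + 1) := by ring
      have h5 : ‖h ^ (n + 1) • derivFst R ((z.1, v), √h)‖ ≤ C * h ^ (n + 1) := by
        rw [norm_smul, Real.norm_of_nonneg hhn, mul_comm]
        exact mul_le_mul_of_nonneg_right hRf hhn
      refine (norm_sub_le_of_le h4 h5).trans ?_
      rw [← add_mul]
      exact mul_le_mul_of_nonneg_right (by nlinarith [mul_nonneg hCG hc0]) hhn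

theorem updateMapErrorBigO_of_generating : UpdateMapErrorBigO L χ W Z eG Ld (n + 1) := by
  intro K hKZ hK
  obtain ⟨C, r, M, h₁, hC, hr, hh₁, hh₁ε, hu⟩ := exists_uniformBounds (W := W) hO hℓ hZ hZO hreg ha
    hB hR hB0 hK hKZ (ε := min (a ^ 2) 1) (by positivity)
  -- The second step contributes `2 * C`, as in the phase space map, and the final momentum of the
  -- first step another `C`.
  set c := C * (3 * C) with hc
  have hc0 : 0 ≤ c := by positivity
  refine ⟨c + CG * c, r, h₁, hr, hh₁, fun h hh z hz γ hγ hγz => ?_⟩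
  have hpos := hh.1
  have hha : √h < a := by
    rw [Real.sqrt_lt' ha]
    exact hh.2.trans_le (hh₁ε.trans (min_le_left _ _))
  have hh1 : h ≤ 1 := hh.2.le.trans (hh₁ε.trans (min_le_right _ _))
  have hhn : 0 ≤ h ^ (n + 1) := by positivity
  have hflow := hu.flow h hh z hz (2 * h) le_rfl (by linarith) γ hγ hγz
  have hM : 0 ≤ M * h := (norm_nonneg _).trans (hflow 0 ⟨le_rfl, by linarith⟩)
  have hM0 : ‖z.1 - z.1‖ ≤ M * h := by simpa using hM
  have hhm : h ∈ Icc 0 (2 * h) := ⟨hpos.le, by linarith⟩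
  have hM1 : ‖γ h - z.1‖ ≤ M * h := (norm_fst_le (jet (2 * h) γ h - z)).trans (hflow h hhm)
  have hγ0 : γ 0 = z.1 := congrArg Prod.fst hγz
  set v := h⁻¹ • (γ h - z.1) with hvdef
  set v' := h⁻¹ • (γ (2 * h) - γ h) with hvdef'
  have hvM : ‖v - z.2‖ ≤ M * h := by
    have := norm_mean_velocity_sub_le hpos le_rfl (by linarith) hγ.1.1 hflow
    rwa [zero_add, hγ0] at this
  have hvM' : ‖v' - z.2‖ ≤ M * h := by
    have := norm_mean_velocity_sub_le hpos hpos.le (by linarith) hγ.1.1 hflow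
    rwa [← two_mul] at this
  have hvr := hvM.trans (hu.small h hh)
  have hvr' := hvM'.trans (hu.small h hh)
  have hvZ : (z.1, v) ∈ Z := hu.mem h hh z hz z.1 v hM0 hvr
  have hvZ' : (γ h, v') ∈ Z := hu.mem h hh z hz (γ h) v' hM1 hvr'
  -- The solution on `[0, 2h]` is cut into two solutions on `[0, h]`, which share the momentum at
  -- time `h`.
  have hγ₁ : IsEulerLagrange (coordLagrangian L χ) W h γ := by
    simpa using IsEulerLagrange.comp_add hpos le_rfl (by linarith) hγ
  have hγ₂ : IsEulerLagrange (coordLagrangian L χ) W h (fun t => γ (t + h)) :=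
    IsEulerLagrange.comp_add hpos hpos.le (by linarith) hγ
  have hj₁ : jet h γ h = jet (2 * h) γ h := by
    simpa using jet_comp_add (t := h) hpos le_rfl (by linarith) hγ.1.1 ⟨hpos.le, le_rfl⟩
  have hj₂ : jet h (fun t => γ (t + h)) 0 = jet (2 * h) γ h := by
    simpa using jet_comp_add (t := 0) hpos hpos.le (by linarith) hγ.1.1 ⟨le_rfl, hpos.le⟩
  have hE₁ := (hE h hpos hha γ hγ₁ (by rw [hγ0]; exact hvZ)).2
  have hE₂ := (hE h hpos hha _ hγ₂ (by
    simp only [zero_add, ← two_mul, ← hvdef']; exact hvZ')).1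
  rw [hγ0, ← hvdef, hj₁] at hE₁
  rw [hj₂] at hE₂
  simp only [zero_add, ← two_mul, ← hvdef'] at hE₂
  have hL₁ : partialTwo Ld χ h (γ 0) (γ h) = derivSnd B ((z.1, v), √h) := by
    rw [hγ0]
    exact (hLd h hpos hha z.1 (γ h) hvZ).2
  have hL₂ : ∀ y, ‖h⁻¹ • (y - γ h) - z.2‖ ≤ r → partialOne Ld χ h (γ h) y =
      -generatedMomentum B ((γ h, h⁻¹ • (y - γ h)), √h) := fun y hy =>
    (hLd h hpos hha (γ h) y (hu.mem h hh z hz (γ h) _ hM1 hy)).1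
  refine ⟨?_, ?_⟩
  · obtain ⟨u, hur, hup⟩ := hu.exists_update h hh z hz (γ h) z.1 v hM1 hM0 hvM
    have huy : h⁻¹ • (γ h + h • u - γ h) = u := by
      rw [add_sub_cancel_left, smul_smul, inv_mul_cancel₀ hpos.ne', one_smul]
    refine ⟨γ h + h • u, ?_, ?_⟩
    · rw [← norm_inv_smul_sub_sub_le_iff hpos, huy]
      exact hur
    · rw [hL₁, hL₂ _ (by rw [huy]; exact hur), huy, hup, add_neg_cancel]
  · intro y hyr hy
    have hur : ‖h⁻¹ • (y - γ h) - z.2‖ ≤ r := (norm_inv_smul_sub_sub_le_iff hpos _ _ _).2 hyr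
    rw [hL₁, hL₂ y hur, add_neg_eq_zero] at hy
    set u := h⁻¹ • (y - γ h) with hudef
    have hRs := hu.bound_snd h hh z hz z.1 v hM0 hvr
    have hRs' := hu.bound_snd h hh z hz (γ h) v' hM1 hvr'
    have hRf' := hu.bound_fst h hh z hz (γ h) v' hM1 hvr'
    have huv : ‖u - v'‖ ≤ c * h ^ n := by
      have h1 := hu.inverse h hh z hz (γ h) u v' hM1 hur hvr'
      -- The momentum at time `h` is final for the first piece and initial for the second.
      -- Eliminating it, and using the discrete Euler-Lagrange equation for `u`, leaves only terms
      -- in `R`.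
      have h2 : generatedMomentum B ((γ h, u), √h) - generatedMomentum B ((γ h, v'), √h) =
          h ^ n • (derivSnd R ((γ h, v'), √h) - h • derivFst R ((γ h, v'), √h)) -
            h ^ n • derivSnd R ((z.1, v), √h) := by
        rw [← hy, eq_sub_of_add_eq hE₁.symm, eq_sub_of_add_eq hE₂.symm]
        abel
      have h3 : ‖h ^ n • derivSnd R ((z.1, v), √h)‖ ≤ C * h ^ n := by
        rw [norm_smul, norm_pow, Real.norm_of_nonneg hpos.le, mul_comm]
        exact mul_le_mul_of_nonneg_right hRs (by positivity)
      rw [h2] at h1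
      refine h1.trans ?_
      rw [hc, mul_assoc]
      refine mul_le_mul_of_nonneg_left ?_ hC.le
      refine (norm_sub_le_of_le (norm_pow_smul_sub_le hpos hh1 n hRs' hRf') h3).trans_eq ?_
      ring
    have hyγ : ‖y - γ (2 * h)‖ ≤ c * h ^ (n + 1) :=
      norm_sub_le_of_norm_mean_velocity_sub_le hpos huv
    refine ⟨hyγ.trans (mul_le_mul_of_nonneg_right ?_ hhn), ?_⟩
    · nlinarith [mul_nonneg hCG hc0]
    · have hyW : (y, z.2) ∈ W := by
        have := hu.mem_step h hh z hz (γ h) u hM1 hur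
        rw [hudef, smul_smul, mul_inv_cancel₀ hpos.ne', one_smul, add_sub_cancel] at this
        exact hZW this
      refine (hcondG _ hyW _ (hγ.1.2 (2 * h) ⟨by linarith, le_rfl⟩)).trans ?_
      refine (mul_le_mul_of_nonneg_left hyγ hCG).trans ?_
      rw [← mul_assoc]
      exact mul_le_mul_of_nonneg_right (by linarith) hhn

end ErrorOrder

/-! ### The generating functions of the Galerkin and the exact discrete Lagrangian. -/

section GeneratingFunctions

variable {V : Type*} [NormedAddCommGroup V] [InnerProductSpace ℝ V]

theorem hasFDerivAt_derivFst {F : Type*} [NormedAddCommGroup F] [NormedSpace ℝ F]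
    {f : (V × V) × ℝ → F} {x v : V} {k : ℝ} (hf : DifferentiableAt ℝ f ((x, v), k)) :
    HasFDerivAt (fun y => f ((y, v), k)) (derivFst f ((x, v), k)) x := by
  have h1 : HasFDerivAt (fun u : V => ((u, v), k))
      ((ContinuousLinearMap.inl ℝ (V × V) ℝ).comp (ContinuousLinearMap.inl ℝ V V)) x :=
    HasFDerivAt.comp (g := fun z : V × V => (z, k)) x (hasFDerivAt_prodMk_left (x, v) k)
      (hasFDerivAt_prodMk_left x v)
  exact HasFDerivAt.comp (g := f) x hf.hasFDerivAt h1

/-- The generating function `B + k²ⁿ R`. -/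
def perturbed (B R : (V × V) × ℝ → ℝ) (n : ℕ) (q : (V × V) × ℝ) : ℝ :=
  B q + (q.2 ^ 2) ^ n * R q

theorem contDiffOn_perturbed {B R : (V × V) × ℝ → ℝ} {n : ℕ} {S : Set ((V × V) × ℝ)}
    (hB : ContDiffOn ℝ ∞ B S) (hR : ContDiffOn ℝ ∞ R S) :
    ContDiffOn ℝ ∞ (perturbed B R n) S :=
  hB.add ((by fun_prop : ContDiff ℝ ∞ fun q : (V × V) × ℝ => (q.2 ^ 2) ^ n).contDiffOn.mul hR)

theorem derivSnd_perturbed {B R : (V × V) × ℝ → ℝ} {n : ℕ} {q : (V × V) × ℝ}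
    (hB : DifferentiableAt ℝ B q) (hR : DifferentiableAt ℝ R q) :
    derivSnd (perturbed B R n) q = derivSnd B q + (q.2 ^ 2) ^ n • derivSnd R q := by
  obtain ⟨⟨x, v⟩, k⟩ := q
  have hp : DifferentiableAt ℝ (perturbed B R n) ((x, v), k) :=
    hB.add ((by fun_prop : DifferentiableAt ℝ (fun q : (V × V) × ℝ => (q.2 ^ 2) ^ n) _).mul hR)
  exact (hasFDerivAt_derivSnd hp).unique
    ((hasFDerivAt_derivSnd hB).add ((hasFDerivAt_derivSnd hR).const_mul ((k ^ 2) ^ n)))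

theorem derivFst_perturbed {B R : (V × V) × ℝ → ℝ} {n : ℕ} {q : (V × V) × ℝ}
    (hB : DifferentiableAt ℝ B q) (hR : DifferentiableAt ℝ R q) :
    derivFst (perturbed B R n) q = derivFst B q + (q.2 ^ 2) ^ n • derivFst R q := by
  obtain ⟨⟨x, v⟩, k⟩ := q
  have hp : DifferentiableAt ℝ (perturbed B R n) ((x, v), k) :=
    hB.add ((by fun_prop : DifferentiableAt ℝ (fun q : (V × V) × ℝ => (q.2 ^ 2) ^ n) _).mul hR)
  exact (hasFDerivAt_derivFst hp).unique
    ((hasFDerivAt_derivFst hB).add ((hasFDerivAt_derivFst hR).const_mul ((k ^ 2) ^ n)))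

variable {E : Type*} [NormedAddCommGroup E] [NormedSpace ℝ E]
  {G : Type*} {χ : V → G} {Z : Set (V × V)}

theorem hasGeneratingFunction_of_eq_mul (hZ : IsOpen Z) {Ld : G → G → ℝ → ℝ} {a : ℝ}
    {B : (V × V) × ℝ → ℝ} (hB : ContDiffOn ℝ ∞ B (Z ×ˢ Ioo (-a) a))
    (hLd : ∀ h, 0 < h → √h < a → ∀ z ∈ Z, Ld (χ z.1) (χ (z.1 + h • z.2)) h = h * B (z, √h)) :
    HasGeneratingFunction Ld χ Z a B := by
  intro h hh hha x y hz
  have hk : √h ∈ Ioo (-a) a := ⟨by linarith [Real.sqrt_nonneg h], hha⟩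
  have hd := (hB.differentiableOn (by simp)).differentiableAt
    ((hZ.prod isOpen_Ioo).mem_nhds (⟨hz, hk⟩ : ((x, h⁻¹ • (y - x)), √h) ∈ Z ×ˢ Ioo (-a) a))
  obtain ⟨h1, h2⟩ := hasFDerivAt_of_eq_mul (Q := fun x y => Ld (χ x) (χ y) h) hZ hh.ne'
    (hLd h hh hha) hz hd
  refine ⟨h1.fderiv.trans ?_, h2.fderiv⟩
  rw [generatedMomentum, sqrt_sq_eq_of_pos hh, neg_sub]

/-- The derivatives of the exact discrete Lagrangian are computed twice: from its factorization, and
from the first variation as momenta of the solution. -/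
theorem generatesMomenta_of_eq_mul [TopologicalSpace G] [ChartedSpace E G] {U : Set V}
    (hU : IsOpen U)
    (hχ : ContMDiffOn 𝓘(ℝ, V) 𝓘(ℝ, E) ∞ χ U)
    {W : Set (V × V)} (hWU : W ⊆ U ×ˢ univ) {L : TangentBundle 𝓘(ℝ, E) G → ℝ}
    (hW : IsOpen W) (hℓ : ContDiffOn ℝ ∞ (coordLagrangian L χ) (U ×ˢ univ)) {a : ℝ}
    {P : ℝ → Set (G × G)} {η : ℝ → G → G → ℝ → V}
    (hη : ∀ h, 0 < h → √h < a → ∀ g ∈ P h, IsExactSolution L χ W h (η h g.1 g.2) ∧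
      Joins χ h (η h g.1 g.2) g.1 g.2)
    (hmin : ∀ h, 0 < h → √h < a → ∀ g ∈ P h, ∀ ξ : ℝ → V, IsExactSolution L χ W h ξ →
      Joins χ h ξ g.1 g.2 → ∀ ξ' : ℝ → V, Admissible W h ξ' → Joins χ h ξ' g.1 g.2 →
      action L h (fun t => χ (ξ t)) ≤ action L h (fun t => χ (ξ' t)))
    (hZ : IsOpen Z) (hP : ∀ h, 0 < h → √h < a → ∀ z ∈ Z, (χ z.1, χ (z.1 + h • z.2)) ∈ P h)
    {B R : (V × V) × ℝ → ℝ} {n : ℕ} (hB : ContDiffOn ℝ ∞ B (Z ×ˢ Ioo (-a) a))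
    (hR : ContDiffOn ℝ ∞ R (Z ×ˢ Ioo (-a) a))
    (hLE : ∀ h, 0 < h → √h < a → ∀ z ∈ Z,
      exactLd L χ η (χ z.1) (χ (z.1 + h • z.2)) h = h * perturbed B R n (z, √h)) :
    GeneratesMomenta (coordLagrangian L χ) W Z a n B R := by
  intro h hh hha γ hγ hz
  have hBR := contDiffOn_perturbed (n := n) hB hR
  have hO := hZ.prod (isOpen_Ioo (a := -a) (b := a))
  have hk : √h ∈ Ioo (-a) a := ⟨by linarith [Real.sqrt_nonneg h], hha⟩
  have hm : ((γ 0, h⁻¹ • (γ h - γ 0)), √h) ∈ Z ×ˢ Ioo (-a) a := ⟨hz, hk⟩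
  have hdB := (hB.differentiableOn (by simp)).differentiableAt (hO.mem_nhds hm)
  have hdR := (hR.differentiableOn (by simp)).differentiableAt (hO.mem_nhds hm)
  have hdBR := (hBR.differentiableOn (by simp)).differentiableAt (hO.mem_nhds hm)
  obtain ⟨h1, h2⟩ := hasFDerivAt_of_eq_mul (Q := fun x y => exactLd L χ η (χ x) (χ y) h) hZ hh.ne'
    (hLE h hh hha) hz hdBR
  obtain ⟨h3, h4⟩ := hasGeneratingFunction_of_eq_mul hZ hBR hLE h hh hha _ _ hz
  have hmem : ∀ x y, (x, h⁻¹ • (y - x)) ∈ Z → (χ x, χ y) ∈ P h := fun x y hxy => by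
    have := hP h hh hha _ hxy
    simpa [smul_smul, hh.ne'] using this
  obtain ⟨h5, h6⟩ := partial_exactLd_eq hU hχ hWU hh (hη h hh hha) (hmin h hh hha) hW hℓ hγ
    (by
      have hc : Continuous fun x => (x, h⁻¹ • (γ h - x)) := by fun_prop
      filter_upwards [hc.continuousAt.eventually (hZ.mem_nhds hz)] with x hx using hmem _ _ hx)
    (by
      have hc : Continuous fun y => (γ 0, h⁻¹ • (y - γ 0)) := by fun_prop
      filter_upwards [hc.continuousAt.eventually (hZ.mem_nhds hz)] with y hy using hmem _ _ hy)
    h1.differentiableAt h2.differentiableAt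
  rw [h3, neg_inj] at h5
  rw [← h5, ← h6, h4, generatedMomentum, generatedMomentum, derivSnd_perturbed hdB hdR,
    derivFst_perturbed hdB hdR]
  simp only [sqrt_sq_eq_of_pos hh]
  refine ⟨?_, trivial⟩
  simp only [smul_add, smul_sub, smul_smul, mul_comm]
  abel

theorem generatedMomentum_zero_eq_momentum {ℓ : V × V → ℝ} (hZ : IsOpen Z) {a : ℝ} (ha : 0 < a)
    {B : (V × V) × ℝ → ℝ} (hB : ContDiffOn ℝ ∞ B (Z ×ˢ Ioo (-a) a))
    (hB0 : ∀ z ∈ Z, B (z, 0) = ℓ z) {z : V × V} (hz : z ∈ Z) :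
    generatedMomentum B (z, 0) = momentum ℓ z := by
  have hm : (z, (0 : ℝ)) ∈ Z ×ˢ Ioo (-a) a := ⟨hz, by linarith, ha⟩
  have h1 := hasFDerivAt_derivSnd (x := z.1) (v := z.2) (k := 0)
    ((hB.differentiableOn (by simp)).differentiableAt ((hZ.prod isOpen_Ioo).mem_nhds hm))
  have h2 : (fun u => ℓ (z.1, u)) =ᶠ[𝓝 z.2] fun u => B ((z.1, u), 0) := by
    have hc : Continuous fun u : V => (z.1, u) := by fun_prop
    filter_upwards [hc.continuousAt.eventually (hZ.mem_nhds hz)] with u hu using (hB0 _ hu).symm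
  rw [momentum, (h1.congr_of_eventuallyEq h2).fderiv, generatedMomentum]
  simp

end GeneratingFunctions

end LieGalerkin

theorem mainTheorem1
    {E : Type*} [NormedAddCommGroup E] [NormedSpace ℝ E] [FiniteDimensional ℝ E]
    {G : Type*} [TopologicalSpace G] [ChartedSpace E G] [Group G] [LieGroup 𝓘(ℝ, E) ∞ G]
    -- the Lie algebra with an inner product
    {V : Type*} [NormedAddCommGroup V] [InnerProductSpace ℝ V]
    (e : V ≃L[ℝ] GroupLieAlgebra 𝓘(ℝ, E) G)
    -- the Lagrangian
    (L : TangentBundle 𝓘(ℝ, E) G → ℝ)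
    (hL : ContMDiff 𝓘(ℝ, E).tangent 𝓘(ℝ, ℝ) 2 L)
    -- the natural chart with base point `b`; `W` is the region of positions and velocities in
    -- the Lie algebra to which the assumptions refer
    (Φ : GroupLieAlgebra 𝓘(ℝ, E) G → G) (b : G)
    (χ : V → G) (hχ : χ = LieGalerkin.natChart e Φ b)
    (U : Set V) (hU : IsOpen U)
    (hΦ : IsLocalDiffeomorphOn 𝓘(ℝ, V) 𝓘(ℝ, E) ∞ (fun x : V => Φ (e x)) U)
    (W : Set (V × V)) (hWU : W ⊆ U ×ˢ univ)
    -- the quadrature rule and, for every step, the basis of the approximation space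
    {m : ℕ} (w c : Fin m → ℝ) (hc : ∀ j, c j ∈ Icc (0 : ℝ) 1)
    {ι : Type*} [Fintype ι] (φ : ℝ → ι → ℝ → ℝ)
    (n : ℕ) (h₀ : ℝ) (hh₀ : 0 < h₀)
    (hφ : ∀ h ∈ Ioc 0 h₀, ∀ i, ContDiffOn ℝ 2 (φ h i) (Icc 0 h))
    -- the pairs of end points under consideration, for every step
    (P : ℝ → Set (G × G))
    -- exact solutions with these end points
    (η : ℝ → G → G → ℝ → V)
    (hη : ∀ h ∈ Ioc 0 h₀, ∀ g ∈ P h, LieGalerkin.IsExactSolution L χ W h (η h g.1 g.2) ∧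
      LieGalerkin.Joins χ h (η h g.1 g.2) g.1 g.2)
    -- extremizing curves of the discrete action with these end points
    (ζ : ℝ → G → G → ℝ → V)
    (hζ : ∀ h ∈ Ioc 0 h₀, ∀ g ∈ P h, ζ h g.1 g.2 ∈ LieGalerkin.algebraSpace (φ h) ∧
      LieGalerkin.Admissible W h (ζ h g.1 g.2) ∧ LieGalerkin.Joins χ h (ζ h g.1 g.2) g.1 g.2 ∧
      LieGalerkin.IsDiscreteStationary L χ w c (φ h) h (ζ h g.1 g.2))
    -- best approximation
    (CA CA' : ℝ) (hCA : 0 ≤ CA) (hCA' : 0 ≤ CA')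
    (happrox : ∀ h ∈ Ioc 0 h₀, ∀ g ∈ P h, ∃ ξ ∈ LieGalerkin.algebraSpace (V := V) (φ h),
      LieGalerkin.Admissible W h ξ ∧ LieGalerkin.Joins χ h ξ g.1 g.2 ∧
      ∀ t ∈ Icc 0 h, ‖η h g.1 g.2 t - ξ t‖ ≤ CA * h ^ n ∧
        ‖derivWithin (η h g.1 g.2) (Icc 0 h) t - derivWithin ξ (Icc 0 h) t‖ ≤ CA' * h ^ n)
    -- error functions on `G` and `TG`, and the Lipschitz condition on the Lagrangian
    (eG : G → G → ℝ) (eT : TangentBundle 𝓘(ℝ, E) G → TangentBundle 𝓘(ℝ, E) G → ℝ)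
    (CL : ℝ) (hCL : 0 ≤ CL)
    (hLip : ∀ z ∈ W, ∀ z' ∈ W,
      |L (LieGalerkin.tangentLift χ z) - L (LieGalerkin.tangentLift χ z')| ≤
        CL * (eG (χ z.1) (χ z'.1) +
          eT (LieGalerkin.tangentLift χ z) (LieGalerkin.tangentLift χ z')))
    -- conditioning of the natural chart
    (CG CT CGT : ℝ) (hCG : 0 ≤ CG) (hCT : 0 ≤ CT) (hCGT : 0 ≤ CGT)
    (hcondG : ∀ z ∈ W, ∀ z' ∈ W, eG (χ z.1) (χ z'.1) ≤ CG * ‖z.1 - z'.1‖)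
    (hcondT : ∀ z ∈ W, ∀ z' ∈ W,
      eT (LieGalerkin.tangentLift χ z) (LieGalerkin.tangentLift χ z') ≤
        CT * ‖z.2 - z'.2‖ + CGT * ‖z.1 - z'.1‖)
    -- accuracy of the quadrature rule
    (CQ : ℝ) (hCQ : 0 ≤ CQ)
    (hquad : ∀ h ∈ Ioc 0 h₀, ∀ ξ ∈ LieGalerkin.algebraSpace (V := V) (φ h),
      LieGalerkin.Admissible W h ξ →
      |LieGalerkin.action L h (fun t => χ (ξ t)) -
        LieGalerkin.discreteAction L w c h (fun t => χ (ξ t))| ≤ CQ * h ^ (n + 1))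
    -- stationary points of the discrete action and of the action are minimizers
    (hminDiscrete : ∀ h ∈ Ioc 0 h₀, ∀ g ∈ P h,
      ∀ ξ ∈ LieGalerkin.algebraSpace (V := V) (φ h), LieGalerkin.Admissible W h ξ →
      LieGalerkin.Joins χ h ξ g.1 g.2 → LieGalerkin.IsDiscreteStationary L χ w c (φ h) h ξ →
      ∀ ξ' ∈ LieGalerkin.algebraSpace (V := V) (φ h), LieGalerkin.Admissible W h ξ' →
      LieGalerkin.Joins χ h ξ' g.1 g.2 →
      LieGalerkin.discreteAction L w c h (fun t => χ (ξ t)) ≤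
        LieGalerkin.discreteAction L w c h (fun t => χ (ξ' t)))
    (hminExact : ∀ h ∈ Ioc 0 h₀, ∀ g ∈ P h,
      ∀ ξ : ℝ → V, LieGalerkin.IsExactSolution L χ W h ξ → LieGalerkin.Joins χ h ξ g.1 g.2 →
      ∀ ξ' : ℝ → V, LieGalerkin.Admissible W h ξ' → LieGalerkin.Joins χ h ξ' g.1 g.2 →
      LieGalerkin.action L h (fun t => χ (ξ t)) ≤
        LieGalerkin.action L h (fun t => χ (ξ' t))) :
    -- the discrete Lagrangians agree to order `h ^ (n + 1)`
    (∀ h ∈ Ioc 0 h₀, ∀ g ∈ P h,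
      |LieGalerkin.exactLd L χ η g.1 g.2 h - LieGalerkin.galerkinLd L χ w c ζ g.1 g.2 h| ≤
        (CQ + CL * ((CG + CGT) * CA + CT * CA')) * h ^ (n + 1)) ∧
    -- in the smooth regular setting, the integrator has error of order `h ^ (n + 1)`
    (∀ Z : Set (V × V), 1 ≤ n → IsOpen W → IsOpen Z → Z ⊆ W →
      (∀ h ∈ Ioc 0 h₀, ∀ z ∈ Z, (χ z.1, χ (z.1 + h • z.2)) ∈ P h) →
      ContMDiff 𝓘(ℝ, E).tangent 𝓘(ℝ, ℝ) ∞ L →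
      LieGalerkin.RegularOn (LieGalerkin.coordLagrangian L χ) Z →
      LieGalerkin.SmoothUpToZero (LieGalerkin.exactLd L χ η) χ Z h₀ →
      LieGalerkin.SmoothUpToZero (LieGalerkin.galerkinLd L χ w c ζ) χ Z h₀ →
      LieGalerkin.PhaseMapErrorBigO L χ W Z eG (LieGalerkin.galerkinLd L χ w c ζ) (n + 1) ∧
      LieGalerkin.UpdateMapErrorBigO L χ W Z eG (LieGalerkin.galerkinLd L χ w c ζ) (n + 1)) := by
  have hχs : ContMDiffOn 𝓘(ℝ, V) 𝓘(ℝ, E) ∞ χ U :=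
    hχ ▸ LieGalerkin.contMDiffOn_natChart e Φ b hΦ
  have hLdiff : ∀ h ∈ Ioc 0 h₀, ∀ g ∈ P h,
      |LieGalerkin.exactLd L χ η g.1 g.2 h - LieGalerkin.galerkinLd L χ w c ζ g.1 g.2 h| ≤
        (CQ + CL * ((CG + CGT) * CA + CT * CA')) * h ^ (n + 1) := by
    intro h hh g hg
    obtain ⟨hηs, hηJ⟩ := hη h hh g hg
    obtain ⟨hζA, hζa, hζJ, hζs⟩ := hζ h hh g hg
    obtain ⟨ξ, hξA, hξa, hξJ, hξ⟩ := happrox h hh g hg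
    -- The sandwich: `h1` and `h2` bound `exactLd - galerkinLd` from above, `h3`, `h4` and `h5` from
    -- below, each side using the quadrature error once.
    have h1 := hminExact h hh g hg _ hηs hηJ _ hζa hζJ
    have h2 := abs_le.1 (hquad h hh _ hζA hζa)
    have h3 := hminDiscrete h hh g hg _ hζA hζa hζJ hζs ξ hξA hξa hξJ
    have h4 := abs_le.1 (hquad h hh ξ hξA hξa)
    have h5 := abs_le.1 (LieGalerkin.abs_action_sub_action_le hU hχs hWU hL hCL hLip hCG hCT hCGT
      hcondG hcondT hh.1 hηs.1 hξa (fun t ht => (hξ t ht).1) (fun t ht => (hξ t ht).2))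
    have h6 : CL * ((CG + CGT) * (CA * h ^ n) + CT * (CA' * h ^ n)) * h =
        CL * ((CG + CGT) * CA + CT * CA') * h ^ (n + 1) := by ring
    have h7 : 0 ≤ CL * ((CG + CGT) * CA + CT * CA') * h ^ (n + 1) := by
      have := hh.1
      positivity
    rw [h6] at h5
    rw [LieGalerkin.exactLd, LieGalerkin.galerkinLd, add_mul, abs_le]
    constructor <;> linarith [h2.1, h2.2, h4.1, h4.2, h5.1, h5.2]
  refine ⟨hLdiff, ?_⟩
  intro Z hn hW hZ hZW hP hLs hreg hsE hsG
  have : FiniteDimensional ℝ (GroupLieAlgebra 𝓘(ℝ, E) G) :=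
    inferInstanceAs (FiniteDimensional ℝ E)
  have : FiniteDimensional ℝ V := e.symm.toLinearEquiv.finiteDimensional
  have hℓ : ContDiffOn ℝ ∞ (LieGalerkin.coordLagrangian L χ) (U ×ˢ univ) :=
    LieGalerkin.contDiffOn_coordLagrangian hU hχs (k := ⊤) hLs
  have hO : IsOpen (U ×ˢ (univ : Set V)) := hU.prod isOpen_univ
  have ha : 0 < √h₀ := Real.sqrt_pos.2 hh₀
  have hlt : ∀ h, √h < √h₀ → h < h₀ := fun h hh => lt_of_not_ge fun hle =>
    absurd (Real.sqrt_le_sqrt hle) (not_le.2 hh)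
  have hIoc : ∀ h, 0 < h → √h < √h₀ → h ∈ Ioc 0 h₀ := fun h h1 h2 => ⟨h1, (hlt h h2).le⟩
  have hIoo : ∀ h, √h < √h₀ → √h ∈ Ioo (-√h₀) √h₀ := fun h h2 =>
    ⟨by linarith [Real.sqrt_nonneg h], h2⟩
  -- The discrete action carries a factor `h`, so it vanishes at `h = 0` and can be divided by `h`.
  obtain ⟨B, hB, hGB⟩ := LieGalerkin.exists_eq_sq_mul hZ hh₀ hsG
    (fun z _ => by simp [LieGalerkin.galerkinLd, LieGalerkin.discreteAction])
  obtain ⟨R, hR, hDR⟩ := LieGalerkin.exists_eq_sq_pow_mul hZ hh₀ (hsE.sub hsG) (N := n + 1)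
    (fun z hz h hh => hLdiff h ⟨hh.1, hh.2.le⟩ _ (hP h ⟨hh.1, hh.2.le⟩ z hz))
  have hLG : ∀ h, 0 < h → √h < √h₀ → ∀ z ∈ Z,
      LieGalerkin.galerkinLd L χ w c ζ (χ z.1) (χ (z.1 + h • z.2)) h = h * B (z, √h) := by
    intro h h1 h2 z hz
    have := hGB z hz (√h) (hIoo h h2)
    simpa only [LieGalerkin.sqrt_sq_eq_of_pos h1] using this
  have hLE : ∀ h, 0 < h → √h < √h₀ → ∀ z ∈ Z,
      LieGalerkin.exactLd L χ η (χ z.1) (χ (z.1 + h • z.2)) h =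
        h * LieGalerkin.perturbed B R n (z, √h) := by
    intro h h1 h2 z hz
    have h3 := hDR z hz (√h) (hIoo h h2)
    simp only [LieGalerkin.sqrt_sq_eq_of_pos h1] at h3
    rw [hLG h h1 h2 z hz] at h3
    simp only [LieGalerkin.perturbed, LieGalerkin.sqrt_sq_eq_of_pos h1]
    rw [sub_eq_iff_eq_add.1 h3]
    ring
  have hB0 : ∀ z ∈ Z, B (z, 0) = LieGalerkin.coordLagrangian L χ z := by
    intro z hz
    -- Consistency is proved for the exact generating function `B + h ^ n R`; as `n ≥ 1`, the
    -- perturbation vanishes at `h = 0` and `B` inherits it.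
    have h1 := LieGalerkin.eq_lagrangian_of_action_eq hO hℓ hZ (hZW.trans hWU) hreg hZW ha
      (LieGalerkin.contDiffOn_perturbed (n := n) hB hR).continuousOn ?_ hz hWU
    · rw [← h1, LieGalerkin.perturbed]
      have hn0 : n ≠ 0 := by omega
      simp [hn0]
    · intro h h1 h2 γ hγ hγZ
      have h3 : γ 0 + h • h⁻¹ • (γ h - γ 0) = γ h := by
        rw [smul_smul, mul_inv_cancel₀ h1.ne', one_smul, add_sub_cancel]
      have h4 := hP h (hIoc h h1 h2) _ hγZ
      have h5 := hLE h h1 h2 _ hγZ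
      simp only [h3] at h4 h5
      rw [← h5]
      exact (LieGalerkin.exactLd_eq_integral hU hχs hWU h1 (hη h (hIoc h h1 h2))
        (hminExact h (hIoc h h1 h2)) hγ h4).symm
  have hgen := LieGalerkin.hasGeneratingFunction_of_eq_mul hZ hB hLG
  have hmom := LieGalerkin.generatesMomenta_of_eq_mul hU hχs hWU hW hℓ
    (fun h h1 h2 => hη h (hIoc h h1 h2)) (fun h h1 h2 => hminExact h (hIoc h h1 h2)) hZ
    (fun h h1 h2 => hP h (hIoc h h1 h2)) hB hR hLE
  have hB0' := fun z hz => LieGalerkin.generatedMomentum_zero_eq_momentum hZ ha hB hB0 (z := z) hz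
  exact ⟨LieGalerkin.phaseMapErrorBigO_of_generating hO hℓ hZ (hZW.trans hWU) hZW hreg hCG hcondG
      ha hB hR hB0' hgen hmom,
    LieGalerkin.updateMapErrorBigO_of_generating hO hℓ hZ (hZW.trans hWU) hZW hreg hCG hcondG
      ha hB hR hB0' hgen hmom⟩
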